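/- Let $k,\ell\ge 2$ be standard natural numbers. Over $\mathsf{RCA}_0$ the principles $\mathsf{Baire\text{-}DRT}^k_\ell$, $\mathsf{ODRT}^k_\ell$ and $\mathsf{CDRT}^k_\ell$ defined below are equivalent; that is, in every (not necessarily $\omega$-) model $(M,S)$ of $\mathsf{RCA}_0$, either all three hold or all three fail (by the completeness theorem this says that $\mathsf{RCA}_0$ proves the equivalences). Here $\mathsf{RCA}_0$ is the system of second order arithmetic that consists of the basic axioms for $0,1,+,\cdot,<$, induction for $\Sigma^0_1$ formulas and comprehension for $\Delta^0_1$ formulas (with parameters). The following definitions are made in $\mathsf{RCA}_0$; $\omega$ denotes the set of all numbers, functions are sets of pairs, and finite strings are coded by numbers in the usual way. A function $f$ from $\omega$, or a finite string, with values in $k=\{0,\dots,k-1\}$ or in $\omega$ is *ordered* if, whenever $f(n)=i$ and $j<i$, there is $m<n$ with $f(m)=j$. Let $(\omega)^k$ and $(\omega)^\omega$ be the sets of ordered surjective functions $\omega\to k$ and $\omega\to\omega$, and let $(\omega)^k_{\mathrm{fin}}$ be the set of ordered strings over $k$ in which every $i<k$ appears. For $x\in(\omega)^k$ and $i<k$,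 $\mu^x(i)$ is the least $n$ with $x(n)=i$, and $x\upharpoonright m$ is the initial segment of $x$ of length $m$. For $p\in(\omega)^\omega$, $(p)^k$ is the set of $x\in(\omega)^k$ such that $p(n)=p(m)$ implies $x(n)=x(m)$. A code for an open set in $(\omega)^k$ is a set $O\subseteq\omega\times(\omega)^k_{\mathrm{fin}}$; $x\in(\omega)^k$ is in it, written $x\in O$, if some $\langle n,\sigma\rangle\in O$ has $\sigma\prec x$ (that is, $\sigma$ is an initial segment of $x$). It is dense if for every $\tau\in(\omega)^k_{\mathrm{fin}}$ there is $\langle n,\sigma\rangle\in O$ such that $\sigma$ and $\tau$ are comparable as strings (one of them is an initial segment of the other). A sequence $\{D_n\}_{n<\omega}$ of open sets is coded by a set $D\subseteq\omega\times\omega\times(\omega)^k_{\mathrm{fin}}$, where $D_i=\{\langle n,\sigma\rangle:\langle i,n,\sigma\rangle\in D\}$. A Baire $\ell$-coloring of $(\omega)^k$ is a sequence $\{D_n\}_{n<\omega}$ of dense open sets together with open sets $O_0,\dots,O_{\ell-1}$ whose union is dense. 1. $\mathsf{Baire\text{-}DRT}^k_\ell$: for every Baire $\ell$-coloring $\{O_i\}_{i<\ell}$,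 $\{D_n\}_{n<\omega}$ of $(\omega)^k$ there are $p\in(\omega)^\omega$ and $i<\ell$ such that $x\in O_i\cap\bigcap_n D_n$ for all $x\in(p)^k$. 2. $\mathsf{ODRT}^k_\ell$: for all open sets $O_0,\dots,O_{\ell-1}$ with $(\omega)^k=\bigcup_{i<\ell}O_i$ there are $p\in(\omega)^\omega$ and $i<\ell$ such that $x\in O_i$ for all $x\in(p)^k$. 3. $\mathsf{CDRT}^k_\ell$: for all sets $C_0,\dots,C_{\ell-1}$ with $(\omega)^{k-1}_{\mathrm{fin}}=\bigcup_{i<\ell}C_i$ there are $p\in(\omega)^\omega$ and $i<\ell$ such that $x\upharpoonright\mu^x(k-1)\in C_i$ for all $x\in(p)^k$. -/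

import Mathlib

/-!
Second order arithmetic. A structure for the language `L₂` consists of a number domain `M` with
`0, 1, +, ·, <` and a family `S` of subsets of `M`, over which the set variables range.
The principles below are read inside such a structure `(M, S)`: every quantifier
runs over `M`, over `S`, or over a standard finite index set `Fin ℓ`.
-/

namespace SecondOrderArith

universe u

/-- The first order part of an `L₂`-structure; no laws are assumed. -/
class NumStructure (M : Type u) extends Zero M, One M, Add M, Mul M, LT M

/-! ### Syntax and semantics of bounded formulas -/

/-- Numerical terms of `L₂`, with number variables `v₀, v₁, …`. -/
inductive NumTerm : Type
  | var : ℕ → NumTerm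
  | zero : NumTerm
  | one : NumTerm
  | add : NumTerm → NumTerm → NumTerm
  | mul : NumTerm → NumTerm → NumTerm

/-- Bounded quantifier formulas (`Σ⁰₀`) of `L₂`, with set variables `X₀, X₁, …`.
In `ball t φ` (`∀ v < t, φ`) and `bex t φ` (`∃ v < t, φ`) the bound variable is variable `0` of `φ`,
variable `i + 1` of `φ` is variable `i` outside, and `t` lives outside the quantifier. -/
inductive BddFormula : Type
  | eq : NumTerm → NumTerm → BddFormula
  | lt : NumTerm → NumTerm → BddFormula
  | mem : NumTerm → ℕ → BddFormula
  | neg : BddFormula → BddFormula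
  | and : BddFormula → BddFormula → BddFormula
  | or : BddFormula → BddFormula → BddFormula
  | ball : NumTerm → BddFormula → BddFormula
  | bex : NumTerm → BddFormula → BddFormula

section Semantics

variable {M : Type u} [NumStructure M]

/-- The assignment `v₀ ↦ a`, `vᵢ₊₁ ↦ e i`. -/
def push (a : M) (e : ℕ → M) : ℕ → M
  | 0 => a
  | i + 1 => e i

/-- Value of a term under an assignment of the number variables. -/
def NumTerm.val (e : ℕ → M) : NumTerm → M
  | .var i => e i
  | .zero => 0
  | .one => 1
  | .add s t => s.val e + t.val e
  | .mul s t => s.val e * t.val e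

/-- Truth of a bounded formula under an assignment of number and set variables. -/
def BddFormula.Holds (V : ℕ → Set M) : BddFormula → (ℕ → M) → Prop
  | .eq s t, e => s.val e = t.val e
  | .lt s t, e => s.val e < t.val e
  | .mem t i, e => t.val e ∈ V i
  | .neg φ, e => ¬ φ.Holds V e
  | .and φ ψ, e => φ.Holds V e ∧ ψ.Holds V e
  | .or φ ψ, e => φ.Holds V e ∨ ψ.Holds V e
  | .ball t φ, e => ∀ a : M, a < t.val e → φ.Holds V (push a e)
  | .bex t φ, e => ∃ a : M, a < t.val e ∧ φ.Holds V (push a e)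

/-- The `Σ⁰₁` formula `∃ v, θ` (with matrix `θ`) as a property of `n`, with parameters `e`, `V`. -/
def Sigma01 (θ : BddFormula) (e : ℕ → M) (V : ℕ → Set M) (n : M) : Prop :=
  ∃ a : M, θ.Holds V (push a (push n e))

/-- The `Π⁰₁` formula `∀ v, θ` (with matrix `θ`) as a property of `n`, with parameters `e`, `V`. -/
def Pi01 (θ : BddFormula) (e : ℕ → M) (V : ℕ → Set M) (n : M) : Prop :=
  ∀ a : M, θ.Holds V (push a (push n e))

/-- `(M, S)` is a model of `RCA₀`: the basic axioms, `Σ⁰₁` induction and `Δ⁰₁` comprehension,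
both schemes with number and set parameters. -/
structure IsModelRCA0 (S : Set (Set M)) : Prop where
  sets_nonempty : S.Nonempty
  succ_ne_zero : ∀ n : M, n + 1 ≠ 0
  succ_inj : ∀ m n : M, m + 1 = n + 1 → m = n
  add_zero : ∀ m : M, m + 0 = m
  add_succ : ∀ m n : M, m + (n + 1) = (m + n) + 1
  mul_zero : ∀ m : M, m * 0 = 0
  mul_succ : ∀ m n : M, m * (n + 1) = m * n + m
  not_lt_zero : ∀ m : M, ¬ m < 0
  lt_succ_iff : ∀ m n : M, m < n + 1 ↔ m < n ∨ m = n
  sigma01_induction : ∀ (θ : BddFormula) (e : ℕ → M) (V : ℕ → Set M), (∀ i, V i ∈ S) →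
    Sigma01 θ e V 0 → (∀ n, Sigma01 θ e V n → Sigma01 θ e V (n + 1)) → ∀ n, Sigma01 θ e V n
  delta01_comprehension : ∀ (θ ψ : BddFormula) (e : ℕ → M) (V : ℕ → Set M), (∀ i, V i ∈ S) →
    (∀ n, Sigma01 θ e V n ↔ Pi01 ψ e V n) → {n | Sigma01 θ e V n} ∈ S

/-! ### Coding of pairs, finite sets and finite sequences by numbers -/

/-- The element of `M` denoted by the standard number `n`. -/
def numeral (M : Type u) [NumStructure M] : ℕ → M
  | 0 => 0
  | n + 1 => numeral M n + 1

/-- The pairing function `⟨i, j⟩ = (i + j)² + i`. -/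
def pair (i j : M) : M := (i + j) * (i + j) + i

/-- `c = ⟨b, ⟨m, n⟩⟩` for some `b`, `m`, `n`. -/
def IsTriple (c : M) : Prop := ∃ b m n : M, c = pair b (pair m n)

/-- `x` belongs to the finite set given by `c = ⟨b, ⟨m, n⟩⟩`, that is, `x < b` and
`m (x + 1) + 1` divides `n`. -/
def InCode (c x : M) : Prop :=
  ∃ b m n : M, c = pair b (pair m n) ∧ x < b ∧ ∃ q : M, n = (m * (x + 1) + 1) * q

/-- `c` is the code of a finite set: the least triple that gives this set. -/
def IsFinSetCode (c : M) : Prop :=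
  IsTriple c ∧ ∀ c' : M, c' < c → IsTriple c' → ¬ ∀ x : M, InCode c' x ↔ InCode c x

/-- `s` is the code of a finite sequence of length `l`; the sequence is the finite set of the pairs
`⟨i, s(i)⟩`, `i < l`. -/
def IsSeq (s l : M) : Prop :=
  IsFinSetCode s ∧ (∀ x, InCode s x → ∃ i j, i < l ∧ x = pair i j) ∧
    ∀ i, i < l → ∃! j, InCode s (pair i j)

/-! ### Partitions -/

/-- The set `f` is (the graph of) a function from numbers to numbers. -/
def IsFun (f : Set M) : Prop :=
  (∀ x ∈ f, ∃ i j, x = pair i j) ∧ ∀ i, ∃! j, pair i j ∈ f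

/-- A graph `f` is ordered: a value occurs only after all smaller values have occurred. -/
def IsOrdered (f : Set M) : Prop :=
  ∀ n i, pair n i ∈ f → ∀ j, j < i → ∃ m, m < n ∧ pair m j ∈ f

/-- `p ∈ (ω)^ω`: `p` is an ordered surjective function from numbers to numbers. -/
def IsInfPartition (p : Set M) : Prop :=
  IsFun p ∧ IsOrdered p ∧ ∀ i, ∃ n, pair n i ∈ p

/-- `x ∈ (ω)^k`: `x` is an ordered surjective function from numbers to `{0, …, k - 1}`. -/
def IsPartition (k : ℕ) (x : Set M) : Prop :=
  IsFun x ∧ (∀ n i, pair n i ∈ x → i < numeral M k) ∧ IsOrdered x ∧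
    ∀ i, i < numeral M k → ∃ n, pair n i ∈ x

/-- `s ∈ (ω)^k_fin`: `s` is the code of an ordered finite sequence of numbers `< k` in which all
`i < k` appear. -/
def IsFinPartition (k : ℕ) (s : M) : Prop :=
  (∃ l, IsSeq s l) ∧ (∀ n i, InCode s (pair n i) → i < numeral M k) ∧
    IsOrdered {x | InCode s x} ∧ ∀ i, i < numeral M k → ∃ n, InCode s (pair n i)

/-- `x ∈ (p)^k`: `x` is a `k`-coarsening of `p`. -/
def IsCoarsening (k : ℕ) (p x : Set M) : Prop :=
  IsPartition k x ∧
    ∀ n m a, pair n a ∈ p → pair m a ∈ p → ∀ b, pair n b ∈ x → pair m b ∈ x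

/-- The finite sequence `s` is an initial segment of the function `x` (as graphs: `s ⊆ x`). -/
def IsPrefix (s : M) (x : Set M) : Prop := ∀ y, InCode s y → y ∈ x

/-- Of the finite sequences `s`, `t`, one is an initial segment of the other. -/
def Comparable (s t : M) : Prop :=
  (∀ y, InCode s y → InCode t y) ∨ ∀ y, InCode t y → InCode s y

/-- `m = μ^x(i)` is the least element of the `i`-th block of `x`. -/
def IsMu (x : Set M) (i m : M) : Prop := pair m i ∈ x ∧ ∀ m', m' < m → pair m' i ∉ x

/-- `s = x ↾ m`. -/
def IsRestriction (x : Set M) (m s : M) : Prop := IsSeq s m ∧ IsPrefix s x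

/-! ### Codes for open sets and for Baire colorings -/

/-- `O ⊆ ω × (ω)^k_fin`. -/
def IsOpenCode (k : ℕ) (O : Set M) : Prop :=
  ∀ z ∈ O, ∃ n s, z = pair n s ∧ IsFinPartition k s

/-- `x` is in the open set coded by `O`. -/
def InOpen (O x : Set M) : Prop := ∃ n s, pair n s ∈ O ∧ IsPrefix s x

/-- The open subset of `(ω)^k` coded by `O` is dense. -/
def IsDenseCode (k : ℕ) (O : Set M) : Prop :=
  ∀ t, IsFinPartition k t → ∃ n s, pair n s ∈ O ∧ Comparable s t

/-- `D ⊆ ω × ω × (ω)^k_fin`, a code for a sequence of open sets. -/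
def IsOpenSeqCode (k : ℕ) (D : Set M) : Prop :=
  ∀ z ∈ D, ∃ i n s, z = pair i (pair n s) ∧ IsFinPartition k s

/-- The code of the `i`-th open set in the sequence coded by `D`. -/
def openSection (D : Set M) (i : M) : Set M := {z | pair i z ∈ D}

/-- `O` and `D` form a code for a Baire `ℓ`-coloring of `(ω)^k`. -/
def IsBaireColoring (k : ℕ) {ℓ : ℕ} (O : Fin ℓ → Set M) (D : Set M) : Prop :=
  IsOpenSeqCode k D ∧ (∀ n, IsDenseCode k (openSection D n)) ∧
    (∀ i, IsOpenCode k (O i)) ∧ IsDenseCode k (⋃ i, O i)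

/-- The sets `O i` form an open `ℓ`-coloring of `(ω)^k`, in the structure `(M, S)`. -/
def IsOpenColoring (S : Set (Set M)) (k : ℕ) {ℓ : ℕ} (O : Fin ℓ → Set M) : Prop :=
  (∀ i, IsOpenCode k (O i)) ∧ ∀ x ∈ S, IsPartition k x → ∃ i, InOpen (O i) x

/-- The sets `C i` form an `ℓ`-coloring of `(ω)^k_fin`. -/
def IsStringColoring (k : ℕ) {ℓ : ℕ} (C : Fin ℓ → Set M) : Prop :=
  (∀ i, ∀ s ∈ C i, IsFinPartition k s) ∧ ∀ s, IsFinPartition k s → ∃ i, s ∈ C i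

/-! ### The three versions of the dual Ramsey theorem, in the structure `(M, S)` -/

/-- `Baire-DRT^k_ℓ` -/
def BaireDRT (S : Set (Set M)) (k ℓ : ℕ) : Prop :=
  ∀ (O : Fin ℓ → Set M) (D : Set M), (∀ i, O i ∈ S) → D ∈ S → IsBaireColoring k O D →
    ∃ p ∈ S, IsInfPartition p ∧ ∃ i : Fin ℓ, ∀ x ∈ S, IsCoarsening k p x →
      InOpen (O i) x ∧ ∀ n, InOpen (openSection D n) x

/-- `ODRT^k_ℓ` -/
def ODRT (S : Set (Set M)) (k ℓ : ℕ) : Prop :=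
  ∀ O : Fin ℓ → Set M, (∀ i, O i ∈ S) → IsOpenColoring S k O →
    ∃ p ∈ S, IsInfPartition p ∧ ∃ i : Fin ℓ, ∀ x ∈ S, IsCoarsening k p x → InOpen (O i) x

/-- `CDRT^k_ℓ` (used for `k ≥ 2`) -/
def CDRT (S : Set (Set M)) (k ℓ : ℕ) : Prop :=
  ∀ C : Fin ℓ → Set M, (∀ i, C i ∈ S) → IsStringColoring (k - 1) C →
    ∃ p ∈ S, IsInfPartition p ∧ ∃ i : Fin ℓ, ∀ x ∈ S, IsCoarsening k p x →
      ∃ m s, IsMu x (numeral M (k - 1)) m ∧ IsRestriction x m s ∧ s ∈ C i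

end Semantics

end SecondOrderArith

/-! An open coloring is a Baire coloring in which every `D_n` is the union of the colors, and a
coloring of `(k-1)`-strings colors `x` by the color of `x ↾ μ^x(k-1)`, which is an open condition.
So `BaireDRT.odrt` and `ODRT.cdrt` are matters of coding; the content is in `CDRT.baireDRT`.

There, put `E_0 = ⋃ O_i` and `E_{n+1} = D_n`. A generic `y ∈ (ω)^ω` is built as the union of nested
strings `F t` with values exactly `{0, …, t}`, such that for `t > 0`, every `g ∈ (ω)^k_fin` of
length `t + 1` and every `n ≤ t`, the composition `g ∘ F t` extends a string of `E_n`
(`exists_generic_strings`). A single requirement is met by density: prolong `g ∘ y` to contain a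
string of `E_n` and lift the new symbols through `g`, which is onto `k`, so that no new value is
needed (`exists_extension_meets`). Each stage has finitely many `g`, and a met requirement stays met
under extension. A `(k-1)`-string `t` of length `l` is then given a color `c` such that `(t⌢(k-1)) ∘
F l` extends a string of `O_c`. If `q` is homogeneous for this coloring, with color `c`, let `p = q
∘ y`. Every `x ∈ (p)^k` is `h ∘ y` with `h ∈ (q)^k` (`IsCoarsening.exists_factor`); `h ↾ μ^h(k-1)`
puts `x` in `O_c`, and longer initial segments of `h` put `x` in every `D_n`.

Since the model may be nonstandard, every induction and comprehension needs a complexity check. The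
complexity classes are semantic predicates closed under connectives, bounded quantifiers and
substitution, and instance search does the check. `IsTerm` and `IsBdd` ask for a term or formula
under every assignment that realizes the variables and parameters, so no numbering of variables has
to be maintained. The tools from arithmetic are `Σ⁰₁` collection (`IsSigma.ball`), selectors
(`exists_selector`), codes of bounded `Δ⁰₁` sets (`IsCodeBound.exists_code`) and primitive recursion
(`exists_recursion`). -/

namespace SecondOrderArith

universe u

set_option synthInstance.maxSize 10000
set_option synthInstance.maxHeartbeats 200000

/-! ### Definability with parameters, semantically

A predicate on a finite product of copies of `M` is treated as a plain predicate;
`IsBdd S P` says that it is given by a bounded formula with parameters from `M` and `S`. -/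

section Definability

variable {M : Type u} [NumStructure M]

/-- Terms with all variables shifted by one. -/
def NumTerm.shift : NumTerm → NumTerm
  | .var i => .var (i + 1)
  | .zero => .zero
  | .one => .one
  | .add s t => .add s.shift t.shift
  | .mul s t => .mul s.shift t.shift

theorem NumTerm.val_shift (t : NumTerm) (a : M) (e : ℕ → M) :
    t.shift.val (push a e) = t.val e := by
  induction t with
  | var i => rfl
  | zero => rfl
  | one => rfl
  | add s t hs ht => simp only [NumTerm.shift, NumTerm.val, hs, ht]
  | mul s t hs ht => simp only [NumTerm.shift, NumTerm.val, hs, ht]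

/-- A finite product of copies of `M`, with its coordinate functions. -/
class Ctx (M : Type u) (α : Type u) where
  coords : Set (α → M)
  finite : coords.Finite

instance : Ctx M M := ⟨{id}, Set.finite_singleton _⟩

instance : Ctx M PUnit.{u + 1} := ⟨∅, Set.finite_empty⟩

instance {α β : Type u} [Ctx M α] [Ctx M β] : Ctx M (α × β) :=
  ⟨(fun c x => c x.1) '' Ctx.coords (M := M) (α := α) ∪
    (fun c x => c x.2) '' Ctx.coords (M := M) (α := β),
    (Ctx.finite.image _).union (Ctx.finite.image _)⟩

/-- Along `g`, all coordinates and the constants from `A` are values of terms under `E`. -/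
def Realizes {α γ : Type u} [Ctx M α] (A : Set M) (g : γ → α) (E : γ → ℕ → M) : Prop :=
  (∀ c ∈ Ctx.coords (M := M) (α := α), ∃ t : NumTerm, ∀ x, c (g x) = t.val (E x)) ∧
    ∀ a ∈ A, ∃ t : NumTerm, ∀ x, a = t.val (E x)

theorem Realizes.mono {α γ : Type u} [Ctx M α] {A B : Set M} {g : γ → α} {E : γ → ℕ → M}
    (h : Realizes B g E) (hAB : A ⊆ B) : Realizes A g E :=
  ⟨h.1, fun a ha => h.2 a (hAB ha)⟩

/-- The passage under a quantifier: the bound variable becomes variable `0` and all earlier terms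
are shifted. -/
theorem Realizes.push {α γ : Type u} [Ctx M α] {A : Set M} {g : γ → α} {E : γ → ℕ → M}
    (h : Realizes A g E) :
    Realizes A (fun y : γ × M => (g y.1, y.2)) (fun y => push y.2 (E y.1)) := by
  refine ⟨?_, fun a ha => ?_⟩
  · rintro c (⟨d, hd, rfl⟩ | ⟨d, hd, rfl⟩)
    · obtain ⟨t, ht⟩ := h.1 d hd
      exact ⟨t.shift, fun y => by rw [NumTerm.val_shift]; exact ht y.1⟩
    · obtain rfl : d = id := hd
      exact ⟨.var 0, fun y => rfl⟩
  · obtain ⟨t, ht⟩ := h.2 a ha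
    exact ⟨t.shift, fun y => by rw [NumTerm.val_shift]; exact ht y.1⟩

/-- `f` is given by a term with parameters. -/
class IsTerm {α : Type u} [Ctx M α] (f : α → M) : Prop where
  out : ∃ A : Set M, A.Finite ∧ ∀ (γ : Type u) (g : γ → α) (E : γ → ℕ → M), Realizes A g E →
    ∃ t : NumTerm, ∀ x, f (g x) = t.val (E x)

/-- A map between contexts whose components are given by terms. -/
class IsTermMap (M : Type u) [NumStructure M] {α β : Type u} [Ctx M α] [Ctx M β]
    (f : α → β) : Prop where
  out : ∀ c ∈ Ctx.coords (M := M) (α := β), IsTerm (fun x => c (f x))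

section

variable {α β γ : Type u} [Ctx M α] [Ctx M β] [Ctx M γ]

theorem IsTermMap.const (b : β) : IsTermMap M (fun _ : α => b) :=
  ⟨fun c _ => ⟨{c b}, Set.finite_singleton _, fun _ _ _ hE => hE.2 _ rfl⟩⟩

instance (priority := low) IsTermMap.prodMk (f : α → β) (g : α → γ) [hf : IsTermMap M f]
    [hg : IsTermMap M g] : IsTermMap M (fun x => (f x, g x)) :=
  ⟨fun c hc => by
    rcases hc with ⟨d, hd, rfl⟩ | ⟨d, hd, rfl⟩
    · exact hf.out d hd
    · exact hg.out d hd⟩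

instance IsTermMap.fst (f : α → β × γ) [h : IsTermMap M f] : IsTermMap M (fun x => (f x).1) :=
  ⟨fun c hc => h.out (fun y => c y.1) (Or.inl ⟨c, hc, rfl⟩)⟩

instance IsTermMap.snd (f : α → β × γ) [h : IsTermMap M f] : IsTermMap M (fun x => (f x).2) :=
  ⟨fun c hc => h.out (fun y => c y.2) (Or.inr ⟨c, hc, rfl⟩)⟩

instance IsTermMap.unit : IsTermMap M (fun _ : α => PUnit.unit.{u + 1}) := IsTermMap.const _

instance IsTermMap.id : IsTermMap M (fun x : α => x) :=
  ⟨fun c hc => ⟨∅, Set.finite_empty, fun _ _ _ hE => hE.1 c hc⟩⟩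

end

/-- `P` is given by a bounded formula with parameters from `M` and `S`. -/
class IsBdd (S : Set (Set M)) {α : Type u} [Ctx M α] (P : α → Prop) : Prop where
  out : ∃ A : Set M, A.Finite ∧ ∃ G : Set (Set M), G.Finite ∧ G ⊆ S ∧
    ∀ (γ : Type u) (g : γ → α) (E : γ → ℕ → M) (V : ℕ → Set M), Realizes A g E →
      (∀ X ∈ G, ∃ i, V i = X) → ∃ θ : BddFormula, ∀ x, P (g x) ↔ θ.Holds V (E x)

section

variable {α β : Type u} [Ctx M α] [Ctx M β]

instance IsTerm.of_map (f : α → M) [h : IsTermMap M f] : IsTerm f := h.out id rfl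

instance IsTerm.const (c : M) : IsTerm (fun _ : α => c) :=
  ⟨{c}, Set.finite_singleton c, fun _ _ _ hE => hE.2 c rfl⟩

instance IsTerm.add (f g : α → M) [hf : IsTerm f] [hg : IsTerm g] :
    IsTerm (fun x => f x + g x) := by
  obtain ⟨A, hA, HA⟩ := hf.out
  obtain ⟨B, hB, HB⟩ := hg.out
  refine ⟨A ∪ B, hA.union hB, fun γ p E hE => ?_⟩
  obtain ⟨s, hs⟩ := HA γ p E (hE.mono Set.subset_union_left)
  obtain ⟨t, ht⟩ := HB γ p E (hE.mono Set.subset_union_right)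
  exact ⟨.add s t, fun x => by rw [hs, ht]; rfl⟩

instance IsTerm.mul (f g : α → M) [hf : IsTerm f] [hg : IsTerm g] :
    IsTerm (fun x => f x * g x) := by
  obtain ⟨A, hA, HA⟩ := hf.out
  obtain ⟨B, hB, HB⟩ := hg.out
  refine ⟨A ∪ B, hA.union hB, fun γ p E hE => ?_⟩
  obtain ⟨s, hs⟩ := HA γ p E (hE.mono Set.subset_union_left)
  obtain ⟨t, ht⟩ := HB γ p E (hE.mono Set.subset_union_right)
  exact ⟨.mul s t, fun x => by rw [hs, ht]; rfl⟩

theorem IsTerm.fst {f : α → M} (hf : IsTerm f) : IsTerm (fun y : α × β => f y.1) := by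
  obtain ⟨A, hA, H⟩ := hf.out
  refine ⟨A, hA, fun γ g E hE => H γ (fun x => (g x).1) E ⟨fun c hc => ?_, hE.2⟩⟩
  exact hE.1 (fun y => c y.1) (Or.inl ⟨c, hc, rfl⟩)

theorem IsTermMap.comp_fst {γ : Type u} [Ctx M γ] (f : α → γ) [hf : IsTermMap M f] :
    IsTermMap M (fun y : α × β => f y.1) :=
  ⟨fun c hc => (hf.out c hc).fst⟩

variable {S : Set (Set M)}

theorem IsBdd.congr {P Q : α → Prop} (h : IsBdd S P) (hPQ : ∀ x, Q x ↔ P x) : IsBdd S Q := by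
  have : Q = P := funext fun x => propext (hPQ x)
  rw [this]; exact h

/-- No syntactic substitution is needed: the formula for `P` is requested along `f ∘ g`, whose
coordinates are again terms. -/
theorem IsBdd.comp {P : β → Prop} (h : IsBdd S P) (f : α → β) [hf : IsTermMap M f] :
    IsBdd S (fun x => P (f x)) := by
  obtain ⟨A, hA, G, hG, hGS, H⟩ := h.out
  choose! B hB HB using fun c hc => (hf.out c hc).out
  refine ⟨A ∪ ⋃ c ∈ Ctx.coords (M := M) (α := β), B c, hA.union (Ctx.finite.biUnion hB), G, hG,
    hGS, fun γ g E V hE hV => H γ (fun x => f (g x)) E V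
      ⟨fun c hc => HB c hc γ g E (hE.mono ?_), fun a ha => hE.2 a (Or.inl ha)⟩ hV⟩
  exact fun a ha => Or.inr (Set.mem_biUnion hc ha)

instance IsBdd.eq (f g : α → M) [hf : IsTerm f] [hg : IsTerm g] :
    IsBdd S (fun x => f x = g x) := by
  obtain ⟨A, hA, HA⟩ := hf.out
  obtain ⟨B, hB, HB⟩ := hg.out
  refine ⟨A ∪ B, hA.union hB, ∅, Set.finite_empty, Set.empty_subset _, fun γ p E V hE _ => ?_⟩
  obtain ⟨s, hs⟩ := HA γ p E (hE.mono Set.subset_union_left)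
  obtain ⟨t, ht⟩ := HB γ p E (hE.mono Set.subset_union_right)
  exact ⟨.eq s t, fun x => by rw [hs, ht]; rfl⟩

instance IsBdd.lt (f g : α → M) [hf : IsTerm f] [hg : IsTerm g] :
    IsBdd S (fun x => f x < g x) := by
  obtain ⟨A, hA, HA⟩ := hf.out
  obtain ⟨B, hB, HB⟩ := hg.out
  refine ⟨A ∪ B, hA.union hB, ∅, Set.finite_empty, Set.empty_subset _, fun γ p E V hE _ => ?_⟩
  obtain ⟨s, hs⟩ := HA γ p E (hE.mono Set.subset_union_left)
  obtain ⟨t, ht⟩ := HB γ p E (hE.mono Set.subset_union_right)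
  exact ⟨.lt s t, fun x => by rw [hs, ht]; rfl⟩

theorem IsBdd.mem {X : Set M} (hX : X ∈ S) (f : α → M) [hf : IsTerm f] :
    IsBdd S (fun x => f x ∈ X) := by
  obtain ⟨A, hA, HA⟩ := hf.out
  refine ⟨A, hA, {X}, Set.finite_singleton X, Set.singleton_subset_iff.2 hX,
    fun γ p E V hE hV => ?_⟩
  obtain ⟨s, hs⟩ := HA γ p E hE
  obtain ⟨i, hi⟩ := hV X rfl
  exact ⟨.mem s i, fun x => by rw [hs, ← hi]; rfl⟩

instance IsBdd.not (P : α → Prop) [hP : IsBdd S P] : IsBdd S (fun x => ¬ P x) := by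
  obtain ⟨A, hA, G, hG, hGS, H⟩ := hP.out
  refine ⟨A, hA, G, hG, hGS, fun γ p E V hE hV => ?_⟩
  obtain ⟨θ, hθ⟩ := H γ p E V hE hV
  exact ⟨.neg θ, fun x => by rw [hθ]; rfl⟩

instance IsBdd.and (P Q : α → Prop) [hP : IsBdd S P] [hQ : IsBdd S Q] :
    IsBdd S (fun x => P x ∧ Q x) := by
  obtain ⟨A, hA, G, hG, hGS, HP⟩ := hP.out
  obtain ⟨B, hB, F, hF, hFS, HQ⟩ := hQ.out
  refine ⟨A ∪ B, hA.union hB, G ∪ F, hG.union hF, Set.union_subset hGS hFS,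
    fun γ p E V hE hV => ?_⟩
  obtain ⟨θ, hθ⟩ := HP γ p E V (hE.mono Set.subset_union_left) (fun X hX => hV X (Or.inl hX))
  obtain ⟨ψ, hψ⟩ := HQ γ p E V (hE.mono Set.subset_union_right) (fun X hX => hV X (Or.inr hX))
  exact ⟨.and θ ψ, fun x => by rw [hθ, hψ]; rfl⟩

instance IsBdd.or (P Q : α → Prop) [hP : IsBdd S P] [hQ : IsBdd S Q] :
    IsBdd S (fun x => P x ∨ Q x) :=
  (inferInstance : IsBdd S fun x => ¬ (¬ P x ∧ ¬ Q x)).congr fun x => by tauto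

instance IsBdd.imp (P Q : α → Prop) [hP : IsBdd S P] [hQ : IsBdd S Q] :
    IsBdd S (fun x => P x → Q x) :=
  (inferInstance : IsBdd S fun x => ¬ (P x ∧ ¬ Q x)).congr fun x => by tauto

instance IsBdd.ball (t : α → M) (P : α → M → Prop) [ht : IsTerm t]
    [hP : IsBdd S (fun y : α × M => P y.1 y.2)] :
    IsBdd S (fun x => ∀ a, a < t x → P x a) := by
  obtain ⟨A, hA, HA⟩ := ht.out
  obtain ⟨B, hB, G, hG, hGS, HP⟩ := hP.out
  refine ⟨A ∪ B, hA.union hB, G, hG, hGS, fun γ p E V hE hV => ?_⟩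
  obtain ⟨s, hs⟩ := HA γ p E (hE.mono Set.subset_union_left)
  obtain ⟨θ, hθ⟩ := HP (γ × M) _ _ V (hE.mono Set.subset_union_right).push hV
  refine ⟨.ball s θ, fun x => ?_⟩
  simp only [BddFormula.Holds, ← hs]
  exact forall₂_congr fun a _ => hθ (x, a)

instance IsBdd.bex (t : α → M) (P : α → M → Prop) [ht : IsTerm t]
    [hP : IsBdd S (fun y : α × M => P y.1 y.2)] :
    IsBdd S (fun x => ∃ a, a < t x ∧ P x a) :=
  (inferInstance : IsBdd S fun x => ¬ ∀ a, a < t x → ¬ P x a).congr fun x => by push Not; rfl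

end

/-- Assignments are total on `ℕ`; the default `a` allows an empty parameter set. -/
theorem exists_subset_range {α : Type*} {A : Set α} (hA : A.Finite) (a : α) :
    ∃ e : ℕ → α, Set.range e = insert a A := by
  obtain ⟨e, he⟩ := ((hA.insert a).countable).exists_eq_range ⟨a, Set.mem_insert _ _⟩
  exact ⟨e, he.symm⟩

/-- Bounded predicates of two arguments, in the form used in `IsModelRCA0`. -/
theorem IsBdd.exists_formula {S : Set (Set M)} {X₀ : Set M} (hX₀ : X₀ ∈ S) {P Q : M × M → Prop}
    (hP : IsBdd S P) (hQ : IsBdd S Q) :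
    ∃ (θ ψ : BddFormula) (e : ℕ → M) (V : ℕ → Set M), (∀ i, V i ∈ S) ∧
      (∀ n a, P (n, a) ↔ θ.Holds V (push a (push n e))) ∧
      ∀ n a, Q (n, a) ↔ ψ.Holds V (push a (push n e)) := by
  obtain ⟨A, hA, G, hG, hGS, HP⟩ := hP.out
  obtain ⟨B, hB, F, hF, hFS, HQ⟩ := hQ.out
  obtain ⟨e, he⟩ := exists_subset_range (hA.union hB) 0
  obtain ⟨V, hV⟩ := exists_subset_range (hG.union hF) X₀
  have hE : Realizes (A ∪ B) (fun x : M × M => x) (fun x => push x.2 (push x.1 e)) := by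
    refine ⟨?_, fun a ha => ?_⟩
    · rintro c (⟨d, hd, rfl⟩ | ⟨d, hd, rfl⟩) <;> obtain rfl : d = id := hd
      · exact ⟨.var 1, fun _ => rfl⟩
      · exact ⟨.var 0, fun _ => rfl⟩
    · obtain ⟨i, hi⟩ : a ∈ Set.range e := he ▸ Set.mem_insert_of_mem _ ha
      exact ⟨.var (i + 2), fun _ => hi.symm⟩
  have hV' : ∀ X ∈ G ∪ F, ∃ i, V i = X := fun X hX => by
    have : X ∈ Set.range V := hV ▸ Set.mem_insert_of_mem _ hX
    exact this
  obtain ⟨θ, hθ⟩ := HP _ _ _ V (hE.mono Set.subset_union_left) fun X hX => hV' X (Or.inl hX)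
  obtain ⟨ψ, hψ⟩ := HQ _ _ _ V (hE.mono Set.subset_union_right) fun X hX => hV' X (Or.inr hX)
  refine ⟨θ, ψ, e, V, fun i => ?_, fun n a => hθ (n, a), fun n a => hψ (n, a)⟩
  have : V i ∈ insert X₀ (G ∪ F) := hV ▸ Set.mem_range_self i
  rcases this with h | h | h
  · exact h ▸ hX₀
  · exact hGS h
  · exact hFS h

/-! ### Induction and comprehension for semantically given predicates. -/

namespace IsModelRCA0

variable {S : Set (Set M)}

theorem exists_induction (hS : IsModelRCA0 S) {P : M × M → Prop} (hP : IsBdd S P)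
    (h0 : ∃ a, P (0, a)) (h1 : ∀ n, (∃ a, P (n, a)) → ∃ a, P (n + 1, a)) (n : M) :
    ∃ a, P (n, a) := by
  obtain ⟨X₀, hX₀⟩ := hS.sets_nonempty
  obtain ⟨θ, _, e, V, hV, hθ, _⟩ := hP.exists_formula hX₀ hP
  simp only [hθ] at h0 h1 ⊢
  exact hS.sigma01_induction θ e V hV h0 h1 n

/-- `PUnit` is the empty context: the induction variable is the only variable, everything else in
`P` is a parameter. -/
theorem bdd_induction (hS : IsModelRCA0 S) (P : M → Prop)
    [hP : IsBdd S (fun y : PUnit.{u + 1} × M => P y.2)]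
    (h0 : P 0) (h1 : ∀ n, P n → P (n + 1)) (n : M) : P n := by
  obtain ⟨_, h⟩ := hS.exists_induction (hP.comp (fun x : M × M => (PUnit.unit, x.1))) ⟨0, h0⟩
    (fun n ⟨_, h⟩ => ⟨0, h1 n h⟩) n
  exact h

theorem exists_comprehension (hS : IsModelRCA0 S) {P Q : M × M → Prop} (hP : IsBdd S P)
    (hQ : IsBdd S Q) (h : ∀ n, (∃ a, P (n, a)) ↔ ∀ a, Q (n, a)) : {n | ∃ a, P (n, a)} ∈ S := by
  obtain ⟨X₀, hX₀⟩ := hS.sets_nonempty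
  obtain ⟨θ, ψ, e, V, hV, hθ, hψ⟩ := hP.exists_formula hX₀ hQ
  simp only [hθ, hψ] at h ⊢
  exact hS.delta01_comprehension θ ψ e V hV h

end IsModelRCA0

end Definability

/-! ### Arithmetic in a model -/

/-- The laws of the nonnegative part of a discretely ordered ring. -/
class DiscreteArith (M : Type u) [NumStructure M] : Prop where
  add_zero : ∀ a : M, a + 0 = a
  add_assoc : ∀ a b c : M, a + b + c = a + (b + c)
  add_comm : ∀ a b : M, a + b = b + a
  mul_zero : ∀ a : M, a * 0 = 0
  mul_one : ∀ a : M, a * 1 = a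
  mul_assoc : ∀ a b c : M, a * b * c = a * (b * c)
  mul_comm : ∀ a b : M, a * b = b * a
  mul_add : ∀ a b c : M, a * (b + c) = a * b + a * c
  add_right_cancel : ∀ a b c : M, a + c = b + c → a = b
  lt_iff : ∀ a b : M, a < b ↔ ∃ c, b = a + (c + 1)
  lt_or_eq_or_lt : ∀ a b : M, a < b ∨ a = b ∨ b < a
  add_one_ne_zero : ∀ a : M, a + 1 ≠ 0
  eq_zero_or_add_one : ∀ a : M, a = 0 ∨ ∃ b, a = b + 1

section

variable {M : Type u} [NumStructure M]

theorem IsModelRCA0.discreteArith {S : Set (Set M)} (hS : IsModelRCA0 S) : DiscreteArith M := by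
  have add_assoc : ∀ a b c : M, a + b + c = a + (b + c) := fun a b c =>
    hS.bdd_induction (fun c => a + b + c = a + (b + c)) (by rw [hS.add_zero, hS.add_zero])
      (fun n h => by rw [hS.add_succ, h, hS.add_succ, hS.add_succ]) c
  have zero_add : ∀ a : M, 0 + a = a :=
    hS.bdd_induction (fun c => 0 + c = c) (hS.add_zero 0) (fun n h => by rw [hS.add_succ, h])
  have succ_add : ∀ a b : M, a + 1 + b = a + b + 1 := fun a b =>
    hS.bdd_induction (fun b => a + 1 + b = a + b + 1) (by rw [hS.add_zero, hS.add_zero])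
      (fun n h => by rw [hS.add_succ, h, hS.add_succ]) b
  have add_comm : ∀ a b : M, a + b = b + a := fun a b =>
    hS.bdd_induction (fun b => a + b = b + a) (by rw [hS.add_zero, zero_add])
      (fun n h => by rw [hS.add_succ, h, succ_add]) b
  have mul_add : ∀ a b c : M, a * (b + c) = a * b + a * c := fun a b c =>
    hS.bdd_induction (fun c => a * (b + c) = a * b + a * c)
      (by rw [hS.add_zero, hS.mul_zero, hS.add_zero])
      (fun n h => by rw [hS.add_succ, hS.mul_succ, h, hS.mul_succ, add_assoc]) c
  have mul_assoc : ∀ a b c : M, a * b * c = a * (b * c) := fun a b c =>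
    hS.bdd_induction (fun c => a * b * c = a * (b * c))
      (by rw [hS.mul_zero, hS.mul_zero, hS.mul_zero])
      (fun n h => by rw [hS.mul_succ, hS.mul_succ, h, mul_add]) c
  have zero_mul : ∀ a : M, 0 * a = 0 :=
    hS.bdd_induction (fun c => 0 * c = 0) (hS.mul_zero 0)
      (fun n h => by rw [hS.mul_succ, h, hS.add_zero])
  have succ_mul : ∀ a b : M, (a + 1) * b = a * b + b := fun a b =>
    hS.bdd_induction (fun b => (a + 1) * b = a * b + b)
      (by rw [hS.mul_zero, hS.mul_zero, hS.add_zero])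
      (fun n h => by
        rw [hS.mul_succ, h, hS.mul_succ, add_assoc, add_assoc, ← add_assoc n, add_comm n a,
          add_assoc]) b
  have mul_comm : ∀ a b : M, a * b = b * a := fun a b =>
    hS.bdd_induction (fun b => a * b = b * a) (by rw [hS.mul_zero, zero_mul])
      (fun n h => by rw [hS.mul_succ, h, succ_mul]) b
  have mul_one : ∀ a : M, a * 1 = a := fun a => by
    have := hS.mul_succ a 0
    rwa [zero_add, hS.mul_zero, zero_add] at this
  have cases : ∀ a : M, a = 0 ∨ ∃ b, a = b + 1 := fun a => by
    -- The predecessor is bounded by `c` so that the induction formula is bounded; the same device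
    -- is used for the difference in `lt_iff`.
    have := hS.bdd_induction (fun c => c = 0 ∨ ∃ b, b < c ∧ c = b + 1) (Or.inl rfl)
      (fun n _ => Or.inr ⟨n, (hS.lt_succ_iff n n).2 (Or.inr rfl), rfl⟩) a
    rcases this with h | ⟨b, _, h⟩
    · exact Or.inl h
    · exact Or.inr ⟨b, h⟩
  have lt_add : ∀ a c : M, a < a + (c + 1) := fun a c =>
    hS.bdd_induction (fun c => a < a + (c + 1))
      (by rw [zero_add, hS.lt_succ_iff]; exact Or.inr rfl)
      (fun n h => by rw [hS.add_succ, hS.lt_succ_iff]; exact Or.inl h) c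
  have lt_iff : ∀ a b : M, a < b ↔ ∃ c, b = a + (c + 1) := fun a b => by
    refine ⟨fun h => ?_, fun ⟨c, hc⟩ => hc ▸ lt_add a c⟩
    have := hS.bdd_induction (fun b => a < b → ∃ c, c < b ∧ b = a + (c + 1))
      (fun h => (hS.not_lt_zero a h).elim) (fun n ih h => by
        rcases (hS.lt_succ_iff a n).1 h with h | h
        · obtain ⟨c, hc, hn⟩ := ih h
          refine ⟨c + 1, ?_, by rw [hS.add_succ, ← hn]⟩
          rw [hn, add_comm a, add_assoc (c + 1)]
          exact lt_add _ _
        · refine ⟨0, ?_, by rw [zero_add, h]⟩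
          rcases cases n with hn | ⟨n', hn⟩
          · rw [hn, hS.lt_succ_iff]; exact Or.inr rfl
          · have := lt_add 0 n
            rwa [zero_add] at this) b h
    obtain ⟨c, _, hc⟩ := this
    exact ⟨c, hc⟩
  have tri : ∀ a b : M, a < b ∨ a = b ∨ b < a := fun a b =>
    hS.bdd_induction (fun b => a < b ∨ a = b ∨ b < a)
      (by
        rcases cases a with h | ⟨a', h⟩
        · exact Or.inr (Or.inl h)
        · refine Or.inr (Or.inr ?_)
          have := lt_add 0 a'
          rwa [zero_add, ← h] at this)
      (fun n h => by
        rcases h with h | h | h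
        · exact Or.inl ((hS.lt_succ_iff _ _).2 (Or.inl h))
        · exact Or.inl ((hS.lt_succ_iff _ _).2 (Or.inr h))
        · obtain ⟨c, hc⟩ := (lt_iff _ _).1 h
          rcases cases c with h0 | ⟨c', h0⟩
          · refine Or.inr (Or.inl ?_)
            rw [hc, h0, zero_add]
          · refine Or.inr (Or.inr ?_)
            rw [hc, h0, add_comm (c' + 1), ← add_assoc]
            exact lt_add _ _) b
  refine ⟨hS.add_zero, add_assoc, add_comm, hS.mul_zero, mul_one, mul_assoc, mul_comm, mul_add,
    fun a b c => ?_, lt_iff, tri, hS.succ_ne_zero, cases⟩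
  exact hS.bdd_induction (fun c => a + c = b + c → a = b)
    (fun h => by rwa [hS.add_zero, hS.add_zero] at h)
    (fun n ih h => ih (by rw [hS.add_succ, hS.add_succ] at h; exact hS.succ_inj _ _ h)) c

/-! ### The model as an ordered commutative semiring. -/

variable [DiscreteArith M]

instance : CommSemiring M where
  add_assoc := DiscreteArith.add_assoc
  zero_add a := by rw [DiscreteArith.add_comm, DiscreteArith.add_zero]
  add_zero := DiscreteArith.add_zero
  add_comm := DiscreteArith.add_comm
  left_distrib := DiscreteArith.mul_add
  right_distrib a b c := by
    rw [DiscreteArith.mul_comm, DiscreteArith.mul_add, DiscreteArith.mul_comm c a,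
      DiscreteArith.mul_comm c b]
  zero_mul a := by rw [DiscreteArith.mul_comm, DiscreteArith.mul_zero]
  mul_zero := DiscreteArith.mul_zero
  mul_assoc := DiscreteArith.mul_assoc
  one_mul a := by rw [DiscreteArith.mul_comm, DiscreteArith.mul_one]
  mul_one := DiscreteArith.mul_one
  mul_comm := DiscreteArith.mul_comm
  nsmul := nsmulRec

theorem lt_iff_exists_eq_add (a b : M) : a < b ↔ ∃ c, b = a + (c + 1) :=
  DiscreteArith.lt_iff a b

theorem add_add_one_ne_self (a c : M) : a + (c + 1) ≠ a := fun h =>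
  DiscreteArith.add_one_ne_zero c (DiscreteArith.add_right_cancel _ _ a (by
    rw [add_comm, h, zero_add]))

noncomputable instance : LinearOrder M where
  le a b := a < b ∨ a = b
  lt a b := a < b
  le_refl a := Or.inr rfl
  le_trans a b c := by
    rintro (h | rfl) (h' | rfl)
    · rw [lt_iff_exists_eq_add] at h h'
      obtain ⟨d, rfl⟩ := h
      obtain ⟨e, rfl⟩ := h'
      refine Or.inl ((lt_iff_exists_eq_add _ _).2 ⟨d + 1 + e, ?_⟩)
      ring
    · exact Or.inl h
    · exact Or.inl h'
    · exact Or.inr rfl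
  lt_iff_le_not_ge a b := by
    have key : a < b → b < a → False := fun h h' => by
      rw [lt_iff_exists_eq_add] at h h'
      obtain ⟨d, rfl⟩ := h
      obtain ⟨e, h'⟩ := h'
      exact add_add_one_ne_self a (d + 1 + e) (by rw [eq_comm]; nth_rewrite 1 [h']; ring)
    have irr : a < b → a ≠ b := fun h h' => by
      subst h'; exact key h h
    constructor
    · intro h
      exact ⟨Or.inl h, fun h' => h'.elim (key h) fun h' => irr h h'.symm⟩
    · rintro ⟨h | rfl, h'⟩
      · exact h
      · exact (h' (Or.inr rfl)).elim
  le_antisymm a b := by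
    rintro (h | rfl) (h' | h')
    · rw [lt_iff_exists_eq_add] at h h'
      obtain ⟨d, rfl⟩ := h
      obtain ⟨e, h'⟩ := h'
      exact (add_add_one_ne_self a (d + 1 + e) (by rw [eq_comm]; nth_rewrite 1 [h']; ring)).elim
    all_goals first | rfl | exact h'.symm
  le_total a b := by
    rcases DiscreteArith.lt_or_eq_or_lt a b with h | h | h
    · exact Or.inl (Or.inl h)
    · exact Or.inl (Or.inr h)
    · exact Or.inr (Or.inl h)
  toDecidableLE := Classical.decRel _

instance : CanonicallyOrderedAdd M where
  exists_add_of_le {a b} h := by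
    rcases h.lt_or_eq with h | rfl
    · obtain ⟨c, hc⟩ := (lt_iff_exists_eq_add _ _).1 h
      exact ⟨c + 1, hc⟩
    · exact ⟨0, (add_zero a).symm⟩
  le_add_self a b := by
    rcases DiscreteArith.eq_zero_or_add_one b with rfl | ⟨c, rfl⟩
    · rw [zero_add]
    · exact le_of_lt ((lt_iff_exists_eq_add _ _).2 ⟨c, add_comm _ _⟩)
  le_self_add a b := by
    rcases DiscreteArith.eq_zero_or_add_one b with rfl | ⟨c, rfl⟩
    · rw [add_zero]
    · exact le_of_lt ((lt_iff_exists_eq_add _ _).2 ⟨c, rfl⟩)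

instance : IsStrictOrderedRing M :=
  have add_lt : ∀ a b c : M, a < b → a + c < b + c := fun a b c h => by
    obtain ⟨d, rfl⟩ := (lt_iff_exists_eq_add _ _).1 h
    exact (lt_iff_exists_eq_add _ _).2 ⟨d, by ring⟩
  have mul_lt : ∀ a b c : M, a < b → 0 < c → a * c < b * c := fun a b c h hc => by
    obtain ⟨d, rfl⟩ := (lt_iff_exists_eq_add _ _).1 h
    obtain ⟨e, rfl⟩ := (lt_iff_exists_eq_add _ _).1 hc
    exact (lt_iff_exists_eq_add _ _).2 ⟨(d * e + d + e), by ring⟩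
  { add_le_add_left := fun a b h c => by
      rcases h.lt_or_eq with h | rfl
      · exact (add_lt _ _ _ h).le
      · rfl
    le_of_add_le_add_left := fun c a b h => by
      by_contra hlt
      have := add_lt b a c (not_le.1 hlt)
      rw [add_comm b, add_comm a] at this
      exact absurd h (not_le.2 this)
    zero_le_one := zero_le
    exists_pair_ne := ⟨0, 1, fun h => DiscreteArith.add_one_ne_zero (0 : M) (by rw [zero_add, ← h])⟩
    mul_lt_mul_of_pos_left := fun c hc a b h => by
      have := mul_lt a b c h hc
      rwa [mul_comm, mul_comm b] at this
    mul_lt_mul_of_pos_right := fun c hc a b h => mul_lt a b c h hc }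

theorem lt_add_one_iff_le {a b : M} : a < b + 1 ↔ a ≤ b := by
  constructor
  · intro h
    obtain ⟨c, hc⟩ := (lt_iff_exists_eq_add _ _).1 h
    have : b = a + c := by
      apply DiscreteArith.add_right_cancel _ _ 1
      rw [hc, add_assoc]
    rw [this]; exact le_self_add
  · intro h
    exact h.trans_lt (lt_add_one b)

theorem add_one_le_iff_lt {a b : M} : a + 1 ≤ b ↔ a < b := by
  rw [← lt_add_one_iff_le (M := M), add_lt_add_iff_right]

end

/-! ### `Σ⁰₁` and `Δ⁰₁` predicates, `Δ⁰₁` functions -/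

section

variable {M : Type u} [NumStructure M] {α β : Type u} [Ctx M α] [Ctx M β]

/-- `P` is `Σ⁰₁` with parameters from `M` and `S`. -/
class IsSigma (S : Set (Set M)) (P : α → Prop) : Prop where
  out : ∃ Q : α × M → Prop, IsBdd S Q ∧ ∀ x, P x ↔ ∃ a, Q (x, a)

/-- `P` is `Δ⁰₁` with parameters from `M` and `S`. -/
class IsDelta (S : Set (Set M)) (P : α → Prop) : Prop where
  sigma : IsSigma S P
  pi : IsSigma S (fun x => ¬ P x)

/-- The graph of `f` is `Σ⁰₁` with parameters from `M` and `S`. -/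
class IsFn (S : Set (Set M)) (f : α → M) : Prop where
  out : IsSigma S (fun y : α × M => y.2 = f y.1)

variable {S : Set (Set M)}

theorem IsSigma.congr {P Q : α → Prop} (h : IsSigma S P) (hPQ : ∀ x, Q x ↔ P x) :
    IsSigma S Q := by
  have : Q = P := funext fun x => propext (hPQ x)
  rw [this]; exact h

theorem IsDelta.congr {P Q : α → Prop} (h : IsDelta S P) (hPQ : ∀ x, Q x ↔ P x) :
    IsDelta S Q := by
  have : Q = P := funext fun x => propext (hPQ x)
  rw [this]; exact h

theorem IsBdd.isSigma {P : α → Prop} (h : IsBdd S P) : IsSigma S P :=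
  ⟨fun y => P y.1, h.comp (fun y : α × M => y.1), fun _ => ⟨fun h => ⟨0, h⟩, fun ⟨_, h⟩ => h⟩⟩

theorem IsBdd.isDelta {P : α → Prop} (h : IsBdd S P) : IsDelta S P :=
  ⟨h.isSigma, (IsBdd.not P).isSigma⟩

theorem IsSigma.comp {P : β → Prop} (h : IsSigma S P) (f : α → β) [IsTermMap M f] :
    IsSigma S (fun x => P (f x)) := by
  obtain ⟨Q, hQ, H⟩ := h.out
  have : IsTermMap M (fun y : α × M => f y.1) := IsTermMap.comp_fst f
  exact ⟨fun y => Q (f y.1, y.2), hQ.comp (fun y : α × M => (f y.1, y.2)), fun x => H (f x)⟩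

instance IsSigma.of_delta (P : α → Prop) [h : IsDelta S P] : IsSigma S P := h.sigma

instance IsDelta.not (P : α → Prop) [h : IsDelta S P] : IsDelta S (fun x => ¬ P x) :=
  ⟨h.pi, h.sigma.congr fun _ => not_not⟩

theorem IsFn.of_term (f : α → M) [hf : IsTerm f] : IsFn S f := by
  refine ⟨IsBdd.isSigma ?_⟩
  have : IsTerm (fun y : α × M => f y.1) := hf.fst
  infer_instance

instance IsFn.of_map (f : α → M) [IsTermMap M f] : IsFn S f := IsFn.of_term f

instance IsFn.const (c : M) : IsFn S (fun _ : α => c) := IsFn.of_term _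

theorem IsFn.comp {f : β → M} (h : IsFn S f) (g : α → β) [IsTermMap M g] :
    IsFn S (fun x => f (g x)) :=
  have : IsTermMap M (fun y : α × M => g y.1) := IsTermMap.comp_fst g
  ⟨h.out.comp (fun y : α × M => (g y.1, y.2))⟩

theorem sigma_induction [hS : Fact (IsModelRCA0 S)] (P : M → Prop)
    (h0 : P 0) (h1 : ∀ n, P n → P (n + 1)) (n : M)
    (h : IsSigma S (fun y : PUnit.{u + 1} × M => P y.2) := by infer_instance) : P n := by
  obtain ⟨Q, hQ, H⟩ := h.out
  rw [H (PUnit.unit, n)]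
  refine hS.out.exists_induction (hQ.comp (fun x : M × M => ((PUnit.unit, x.1), x.2))) ?_ ?_ n
  · exact (H (PUnit.unit, 0)).1 h0
  · exact fun n hn => (H (PUnit.unit, n + 1)).1 (h1 n ((H (PUnit.unit, n)).2 hn))

theorem delta_comprehension [hS : Fact (IsModelRCA0 S)] (P : M → Prop)
    (h : IsDelta S (fun y : PUnit.{u + 1} × M => P y.2) := by infer_instance) : {n | P n} ∈ S := by
  obtain ⟨Q, hQ, H⟩ := h.sigma.out
  obtain ⟨R, hR, K⟩ := h.pi.out
  have hQ' := hQ.comp (fun x : M × M => ((PUnit.unit, x.1), x.2))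
  have hR' := hR.comp (fun x : M × M => ((PUnit.unit, x.1), x.2))
  have := hS.out.exists_comprehension hQ' (IsBdd.not _ (hP := hR')) fun n => by
    rw [← H (PUnit.unit, n), ← not_exists, ← K (PUnit.unit, n), not_not]
  convert this using 1
  ext n
  exact H (PUnit.unit, n)

theorem IsFn.fst {f : α → M} [h : IsFn S f] : IsFn S (fun y : α × β => f y.1) := h.comp _

theorem delta_induction [Fact (IsModelRCA0 S)] (P : M → Prop)
    (h0 : P 0) (h1 : ∀ n, P n → P (n + 1)) (n : M)
    (h : IsDelta S (fun y : PUnit.{u + 1} × M => P y.2) := by infer_instance) : P n :=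
  sigma_induction (S := S) P h0 h1 n

variable [DiscreteArith M]

instance IsBdd.le (f g : α → M) [hf : IsTerm f] [hg : IsTerm g] :
    IsBdd S (fun x => f x ≤ g x) :=
  (inferInstance : IsBdd S fun x => f x < g x ∨ f x = g x).congr fun _ => le_iff_lt_or_eq

/-- Two unbounded existential quantifiers contract to one: a single number bounds both witnesses. -/
instance IsSigma.exists (P : α → M → Prop) [h : IsSigma S (fun y : α × M => P y.1 y.2)] :
    IsSigma S (fun x => ∃ a, P x a) := by
  obtain ⟨Q, hQ, H⟩ := h.out
  have := hQ.comp (fun y : ((α × M) × M) × M => ((y.1.1.1, y.1.2), y.2))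
  refine ⟨fun y => ∃ a, a < y.2 ∧ ∃ b, b < y.2 ∧ Q ((y.1, a), b), inferInstance, fun x => ?_⟩
  constructor
  · rintro ⟨a, ha⟩
    obtain ⟨b, hb⟩ := (H (x, a)).1 ha
    exact ⟨max a b + 1, a, lt_add_one_iff_le.2 (le_max_left _ _), b,
      lt_add_one_iff_le.2 (le_max_right _ _), hb⟩
  · rintro ⟨_, a, _, b, _, h⟩
    exact ⟨a, (H (x, a)).2 ⟨b, h⟩⟩

instance IsSigma.and (P Q : α → Prop) [hP : IsSigma S P] [hQ : IsSigma S Q] :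
    IsSigma S (fun x => P x ∧ Q x) := by
  obtain ⟨P', hP', HP⟩ := hP.out
  obtain ⟨Q', hQ', HQ⟩ := hQ.out
  have h1 := hP'.comp (fun y : (α × M) × M => (y.1.1, y.1.2))
  have h2 := hQ'.comp (fun y : (α × M) × M => (y.1.1, y.2))
  have h3 : IsSigma S (fun y : (α × M) × M => P' (y.1.1, y.1.2) ∧ Q' (y.1.1, y.2)) :=
    IsBdd.isSigma inferInstance
  refine (inferInstance : IsSigma S (fun x => ∃ a b, P' (x, a) ∧ Q' (x, b))).congr fun x => ?_
  rw [HP, HQ]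
  exact ⟨fun ⟨⟨a, ha⟩, b, hb⟩ => ⟨a, b, ha, hb⟩, fun ⟨a, b, ha, hb⟩ => ⟨⟨a, ha⟩, b, hb⟩⟩

instance IsSigma.or (P Q : α → Prop) [hP : IsSigma S P] [hQ : IsSigma S Q] :
    IsSigma S (fun x => P x ∨ Q x) := by
  obtain ⟨P', hP', HP⟩ := hP.out
  obtain ⟨Q', hQ', HQ⟩ := hQ.out
  refine ⟨fun y => P' y ∨ Q' y, inferInstance, fun x => ?_⟩
  rw [HP, HQ, exists_or]

instance IsDelta.and (P Q : α → Prop) [hP : IsDelta S P] [hQ : IsDelta S Q] :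
    IsDelta S (fun x => P x ∧ Q x) :=
  have := hP.pi
  have := hQ.pi
  ⟨inferInstance, (inferInstance : IsSigma S fun x => ¬ P x ∨ ¬ Q x).congr fun x => by tauto⟩

instance IsDelta.or (P Q : α → Prop) [hP : IsDelta S P] [hQ : IsDelta S Q] :
    IsDelta S (fun x => P x ∨ Q x) :=
  (inferInstance : IsDelta S fun x => ¬ (¬ P x ∧ ¬ Q x)).congr fun x => by tauto

instance IsDelta.imp (P Q : α → Prop) [hP : IsDelta S P] [hQ : IsDelta S Q] :
    IsDelta S (fun x => P x → Q x) :=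
  (inferInstance : IsDelta S fun x => ¬ (P x ∧ ¬ Q x)).congr fun x => by tauto

instance IsDelta.iff (P Q : α → Prop) [hP : IsDelta S P] [hQ : IsDelta S Q] :
    IsDelta S (fun x => P x ↔ Q x) :=
  (inferInstance : IsDelta S fun x => (P x → Q x) ∧ (Q x → P x)).congr fun x => by tauto

instance IsSigma.imp (P Q : α → Prop) [hP : IsDelta S P] [hQ : IsSigma S Q] :
    IsSigma S (fun x => P x → Q x) :=
  (inferInstance : IsSigma S fun x => ¬ P x ∨ Q x).congr fun x => by tauto

/-! Substitution of functions -/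

/-- The value of `f` is quantified existentially and pinned down by the `Σ⁰₁` graph. As `f` is
total, the same applies to `¬ P`, so `Δ⁰₁` predicates are also closed under substitution. -/
theorem IsSigma.subst {P : α → M → Prop} (h : IsSigma S (fun y : α × M => P y.1 y.2))
    (f : α → M) [hf : IsFn S f] : IsSigma S (fun x => P x (f x)) := by
  have := hf.out
  refine (inferInstance : IsSigma S (fun x => ∃ v, v = f x ∧ P x v)).congr fun x => ?_
  exact ⟨fun h => ⟨_, rfl, h⟩, by rintro ⟨_, rfl, h⟩; exact h⟩

theorem IsSigma.comp₁ {P : M → Prop} (h : IsSigma S (fun y : PUnit.{u + 1} × M => P y.2))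
    (f : α → M) [IsFn S f] : IsSigma S (fun x => P (f x)) :=
  IsSigma.subst (P := fun _ v => P v) (h.comp (fun y : α × M => (PUnit.unit, y.2))) f

theorem IsSigma.comp₂ {P : M → M → Prop} (h : IsSigma S (fun y : M × M => P y.1 y.2))
    (f g : α → M) [IsFn S f] [IsFn S g] : IsSigma S (fun x => P (f x) (g x)) := by
  have : IsFn S (fun y : α × M => g y.1) := IsFn.fst
  exact IsSigma.subst (P := fun x v => P v (g x)) (IsSigma.subst
    (P := fun (y : α × M) v => P y.2 v)
    (h.comp (fun y : (α × M) × M => (y.1.2, y.2))) (fun y => g y.1)) f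

theorem IsSigma.comp₃ {P : M → M → M → Prop}
    (h : IsSigma S (fun y : (M × M) × M => P y.1.1 y.1.2 y.2))
    (f g k : α → M) [IsFn S f] [IsFn S g] [IsFn S k] :
    IsSigma S (fun x => P (f x) (g x) (k x)) := by
  have : IsFn S (fun y : α × M => g y.1) := IsFn.fst
  have : IsFn S (fun y : (α × M) × M => k y.1.1) := IsFn.comp (f := k) inferInstance _
  exact IsSigma.subst (P := fun x v => P v (g x) (k x)) (IsSigma.subst
    (P := fun (y : α × M) v => P y.2 v (k y.1)) (IsSigma.subst
    (P := fun (y : (α × M) × M) v => P y.1.2 y.2 v)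
    (h.comp (fun y : ((α × M) × M) × M => ((y.1.1.2, y.1.2), y.2))) (fun y => k y.1.1))
    (fun y => g y.1)) f

theorem IsDelta.comp₁ {P : M → Prop} (h : IsDelta S (fun y : PUnit.{u + 1} × M => P y.2))
    (f : α → M) [IsFn S f] : IsDelta S (fun x => P (f x)) :=
  ⟨h.sigma.comp₁ f, IsSigma.comp₁ (P := fun v => ¬ P v) h.pi f⟩

theorem IsDelta.comp₂ {P : M → M → Prop} (h : IsDelta S (fun y : M × M => P y.1 y.2))
    (f g : α → M) [IsFn S f] [IsFn S g] : IsDelta S (fun x => P (f x) (g x)) :=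
  ⟨h.sigma.comp₂ f g, IsSigma.comp₂ (P := fun v w => ¬ P v w) h.pi f g⟩

theorem IsDelta.comp₃ {P : M → M → M → Prop}
    (h : IsDelta S (fun y : (M × M) × M => P y.1.1 y.1.2 y.2))
    (f g k : α → M) [IsFn S f] [IsFn S g] [IsFn S k] : IsDelta S (fun x => P (f x) (g x) (k x)) :=
  ⟨h.sigma.comp₃ f g k, IsSigma.comp₃ (P := fun u v w => ¬ P u v w) h.pi f g k⟩

instance IsDelta.eq (f g : α → M) [IsFn S f] [IsFn S g] : IsDelta S (fun x => f x = g x) :=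
  IsDelta.comp₂ (P := fun a b => a = b) (IsBdd.isDelta inferInstance) f g

instance IsDelta.lt (f g : α → M) [IsFn S f] [IsFn S g] : IsDelta S (fun x => f x < g x) :=
  IsDelta.comp₂ (P := fun a b => a < b) (IsBdd.isDelta inferInstance) f g

instance IsDelta.le (f g : α → M) [IsFn S f] [IsFn S g] : IsDelta S (fun x => f x ≤ g x) :=
  IsDelta.comp₂ (P := fun a b => a ≤ b) (IsBdd.isDelta inferInstance) f g

instance IsDelta.mem (X : Set M) [hX : Fact (X ∈ S)] (f : α → M) [IsFn S f] :
    IsDelta S (fun x => f x ∈ X) :=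
  IsDelta.comp₁ (P := fun a => a ∈ X) (IsBdd.isDelta (IsBdd.mem hX.out _)) f

theorem IsFn.comp₁ {F : M → M} (h : IsFn S (fun y : PUnit.{u + 1} × M => F y.2))
    (f : α → M) [hf : IsFn S f] : IsFn S (fun x => F (f x)) := by
  have : IsFn S (fun y : α × M => f y.1) := IsFn.fst
  exact ⟨IsSigma.comp₂ (P := fun a b => a = F b)
    (h.out.comp (fun y : M × M => ((PUnit.unit, y.2), y.1))) _ _⟩

theorem IsFn.comp₂ {F : M → M → M} (h : IsFn S (fun y : M × M => F y.1 y.2))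
    (f g : α → M) [IsFn S f] [IsFn S g] : IsFn S (fun x => F (f x) (g x)) := by
  have : IsFn S (fun y : α × M => f y.1) := IsFn.fst
  have : IsFn S (fun y : α × M => g y.1) := IsFn.fst
  exact ⟨IsSigma.comp₃ (P := fun a b c => a = F b c)
    (h.out.comp (fun y : (M × M) × M => ((y.1.2, y.2), y.1.1))) _ _ _⟩

instance IsFn.add (f g : α → M) [IsFn S f] [IsFn S g] : IsFn S (fun x => f x + g x) :=
  IsFn.comp₂ (F := fun a b => a + b) (IsFn.of_term _) f g

instance IsFn.mul (f g : α → M) [IsFn S f] [IsFn S g] : IsFn S (fun x => f x * g x) :=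
  IsFn.comp₂ (F := fun a b => a * b) (IsFn.of_term _) f g

instance IsFn.pair (f g : α → M) [IsFn S f] [IsFn S g] : IsFn S (fun x => pair (f x) (g x)) := by
  unfold SecondOrderArith.pair; infer_instance

/-! Induction, comprehension and bounded quantifiers -/

variable [hS : Fact (IsModelRCA0 S)]

/-- This is `Σ⁰₁` collection: the witnesses for all `a < n` have a common bound, found by `Σ⁰₁`
induction. -/
instance IsSigma.ball (t : α → M) (P : α → M → Prop) [IsFn S t]
    [h : IsSigma S (fun y : α × M => P y.1 y.2)] : IsSigma S (fun x => ∀ a, a < t x → P x a) := by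
  obtain ⟨Q, hQ, H⟩ := h.out
  suffices IsSigma S (fun y : α × M => ∀ a, a < y.2 → P y.1 a) from
    this.subst (P := fun x v => ∀ a, a < v → P x a) t
  have := hQ.comp (fun y : (((α × M) × M) × M) × M => ((y.1.1.1.1, y.1.2), y.2))
  have hR : IsBdd S (fun y : (α × M) × M => ∀ a, a < y.1.2 → ∃ w, w < y.2 ∧ Q ((y.1.1, a), w)) :=
    inferInstance
  refine ⟨_, hR, fun ⟨x, n⟩ => ⟨fun hx => ?_, fun ⟨c, hc⟩ a ha => ?_⟩⟩
  · have hx' : ∀ a, a < n → ∃ w, Q ((x, a), w) := fun a ha => (H (x, a)).1 (hx a ha)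
    have : IsTermMap M (fun _ : M × M => x) := IsTermMap.const x
    -- The extra premise `a < n` lets the induction run through all numbers, although witnesses are
    -- only known below `n`.
    have hT : IsBdd S (fun y : M × M => ∀ a, a < y.1 → a < n → ∃ w, w < y.2 ∧ Q ((x, a), w)) := by
      have : IsTermMap M (fun y : ((M × M) × M) × M => x) := IsTermMap.const x
      have := hQ.comp (fun y : ((M × M) × M) × M => ((x, y.1.2), y.2))
      infer_instance
    obtain ⟨c, hc⟩ := hS.out.exists_induction hT ⟨0, fun a ha => absurd ha not_lt_zero⟩
      (fun m ⟨c, hc⟩ => by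
        by_cases hm : m < n
        · obtain ⟨w, hw⟩ := hx' m hm
          refine ⟨max c (w + 1), fun a ha han => ?_⟩
          rcases (lt_add_one_iff_le.1 ha).lt_or_eq with h | rfl
          · obtain ⟨v, hv, hv'⟩ := hc a h han
            exact ⟨v, hv.trans_le (le_max_left _ _), hv'⟩
          · exact ⟨w, (lt_add_one w).trans_le (le_max_right _ _), hw⟩
        · exact ⟨c, fun a _ han => hc a (han.trans_le (not_lt.1 hm)) han⟩) n
    exact ⟨c, fun a ha => hc a ha ha⟩
  · obtain ⟨w, _, hw⟩ := hc a ha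
    exact (H (x, a)).2 ⟨w, hw⟩

instance IsDelta.ball (t : α → M) (P : α → M → Prop) [IsFn S t]
    [h : IsDelta S (fun y : α × M => P y.1 y.2)] : IsDelta S (fun x => ∀ a, a < t x → P x a) :=
  have : IsFn S (fun y : α × M => t y.1) := IsFn.fst
  have := h.pi
  ⟨inferInstance, (inferInstance : IsSigma S fun x => ∃ a, a < t x ∧ ¬ P x a).congr fun x => by
    push Not; rfl⟩

instance IsDelta.bex (t : α → M) (P : α → M → Prop) [IsFn S t]
    [h : IsDelta S (fun y : α × M => P y.1 y.2)] : IsDelta S (fun x => ∃ a, a < t x ∧ P x a) :=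
  (inferInstance : IsDelta S fun x => ¬ ∀ a, a < t x → ¬ P x a).congr fun x => by push Not; rfl

instance IsDelta.bex_le (t : α → M) (P : α → M → Prop) [IsFn S t]
    [h : IsDelta S (fun y : α × M => P y.1 y.2)] : IsDelta S (fun x => ∃ a, a ≤ t x ∧ P x a) :=
  (inferInstance : IsDelta S fun x => ∃ a, a < t x + 1 ∧ P x a).congr fun x => by
    simp only [lt_add_one_iff_le]

/-- The index set is standard, so the induction is external and yields a finite disjunction. -/
instance IsDelta.exists_fin {n : ℕ} (P : Fin n → α → Prop) [h : ∀ i, IsDelta S (P i)] :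
    IsDelta S (fun x => ∃ i, P i x) := by
  induction n with
  | zero => exact (inferInstance : IsDelta S (fun _ : α => (0 : M) < 0)).congr fun x => by simp
  | succ n ih =>
    have := ih (fun i => P i.succ)
    exact (inferInstance : IsDelta S (fun x => P 0 x ∨ ∃ i : Fin n, P i.succ x)).congr
      fun x => Fin.exists_fin_succ

theorem exists_least (P : M → Prop) {n : M} (hn : P n)
    (h : IsDelta S (fun y : PUnit.{u + 1} × M => P y.2) := by infer_instance) :
    ∃ m, P m ∧ ∀ i, i < m → ¬ P i := by
  by_contra hcon
  push Not at hcon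
  have : IsDelta S (fun y : (PUnit.{u + 1} × M) × M => P y.2) :=
    IsDelta.comp₁ (P := P) h (fun y : (PUnit.{u + 1} × M) × M => y.2)
  have key := delta_induction (S := S) (fun n => ∀ i, i < n → ¬ P i)
    (fun i hi => absurd hi not_lt_zero) (fun m hm i hi hPi => by
      obtain ⟨j, hj, hPj⟩ := hcon i hPi
      exact hm j (hj.trans_le (lt_add_one_iff_le.1 hi)) hPj) (n + 1)
  exact key n (lt_add_one n) hn

/-- A total `Σ⁰₁` relation has a `Δ⁰₁` selector. -/
theorem exists_selector (R : α → M → Prop) (hR : ∀ x, ∃ a, R x a)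
    (h : IsSigma S (fun y : α × M => R y.1 y.2) := by infer_instance) :
    ∃ f : α → M, IsFn S f ∧ ∀ x, R x (f x) := by
  obtain ⟨Q, hQ, H⟩ := h.out
  let A (x : α) (c a : M) : Prop := a ≤ c ∧ ∃ b, b ≤ c ∧ Q ((x, a), b)
  -- Minimizing `a` alone would not give a `Σ⁰₁` graph. Instead the common bound `c` on value and
  -- witness is minimized first, then `a` for this `c`; both conditions are `Δ⁰₁`.
  let G (x : α) (c a : M) : Prop := A x c a ∧ (∀ c', c' < c → ¬ ∃ a, a ≤ c' ∧ A x c' a) ∧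
    ∀ a', a' < a → ¬ A x c a'
  have key {β : Type u} [Ctx M β] (x : β → α) [IsTermMap M x] (c a : β → M) [IsFn S c] [IsFn S a] :
      IsDelta S (fun y => A (x y) (c y) (a y)) := by
    have h1 : IsDelta S (fun y : (β × M) × M => Q ((x y.1.1, y.1.2), y.2)) := by
      have : IsTermMap M (fun y : β × M => x y.1) := IsTermMap.comp_fst x
      have : IsTermMap M (fun y : (β × M) × M => x y.1.1) := 
        IsTermMap.comp_fst fun y : β × M => x y.1
      exact (hQ.comp (fun y : (β × M) × M => ((x y.1.1, y.1.2), y.2))).isDelta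
    have h2 : IsSigma S (fun y : β => ∃ b, b ≤ c y ∧ Q ((x y, a y), b)) := by
      have : IsFn S (fun y : β × M => c y.1) := IsFn.fst
      exact IsSigma.subst (P := fun y v => ∃ b, b ≤ c y ∧ Q ((x y, v), b)) inferInstance a
    have h3 : IsSigma S (fun y : β => ¬ ∃ b, b ≤ c y ∧ Q ((x y, a y), b)) := by
      have : IsFn S (fun y : β × M => c y.1) := IsFn.fst
      exact IsSigma.subst (P := fun y v => ¬ ∃ b, b ≤ c y ∧ Q ((x y, v), b)) inferInstance a
    have : IsDelta S (fun y : β => ∃ b, b ≤ c y ∧ Q ((x y, a y), b)) := ⟨h2, h3⟩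
    change IsDelta S (fun y => a y ≤ c y ∧ ∃ b, b ≤ c y ∧ Q ((x y, a y), b))
    infer_instance
  have hG : IsSigma S (fun y : α × M => ∃ c, G y.1 c y.2) := inferInstance
  have hex (x : α) : ∃ c a, G x c a := by
    have hx {β : Type u} [Ctx M β] : IsTermMap M (fun _ : β => x) := IsTermMap.const x
    obtain ⟨a, ha⟩ := hR x
    obtain ⟨b, hb⟩ := (H (x, a)).1 ha
    obtain ⟨c, ⟨a', -, ha'⟩, hc⟩ := exists_least (S := S) (fun c => ∃ a, a ≤ c ∧ A x c a)
      (n := max a b) ⟨a, le_max_left _ _, le_max_left _ _, b, le_max_right _ _, hb⟩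
    obtain ⟨a'', ha'', hmin⟩ := exists_least (S := S) (A x c) ha'
    exact ⟨c, a'', ha'', hc, hmin⟩
  have huniq {x : α} {c c' a a' : M} (h : G x c a) (h' : G x c' a') : a = a' := by
    have hcc : c = c' := le_antisymm
      (not_lt.1 fun hlt => h.2.1 c' hlt ⟨a', h'.1.1, h'.1⟩)
      (not_lt.1 fun hlt => h'.2.1 c hlt ⟨a, h.1.1, h.1⟩)
    subst hcc
    exact le_antisymm (not_lt.1 fun hlt => h.2.2 a' hlt h'.1)
      (not_lt.1 fun hlt => h'.2.2 a hlt h.1)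
  choose c f hf using hex
  refine ⟨f, ⟨hG.congr fun y => ?_⟩, fun x => ?_⟩
  · exact ⟨fun hy => ⟨c y.1, hy ▸ hf y.1⟩, fun ⟨_, hy⟩ => huniq hy (hf y.1)⟩
  · obtain ⟨-, b, -, hb⟩ := (hf x).1
    exact (H (x, f x)).2 ⟨b, hb⟩

end

/-! ### Pairs and finite sets -/

section Coding

variable {M : Type u} [NumStructure M] [DiscreteArith M]

theorem left_le_pair (i j : M) : i ≤ pair i j := le_add_self

theorem right_le_pair (i j : M) : j ≤ pair i j := by
  unfold pair
  rcases eq_or_ne (i + j) 0 with h | h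
  · have : j ≤ i + j := le_add_self
    rw [h] at this
    exact this.trans zero_le
  · have h1 : 1 ≤ i + j := by
      rw [← zero_add (1 : M), add_one_le_iff_lt]; exact pos_iff_ne_zero.2 h
    calc j ≤ i + j := le_add_self
      _ = (i + j) * 1 := (mul_one _).symm
      _ ≤ (i + j) * (i + j) := by gcongr
      _ ≤ _ := le_self_add

/-- `pair i j` lies in the interval from `(i + j)²` to below `(i + j + 1)²`, so it determines the
sum, and then `i`. -/
theorem pair_lt_pair_of_add_lt {i j i' j' : M} (h : i + j < i' + j') : pair i j < pair i' j' := by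
  unfold pair
  have h1 : i + j + 1 ≤ i' + j' := add_one_le_iff_lt.2 h
  calc (i + j) * (i + j) + i ≤ (i + j) * (i + j) + (i + j) := by gcongr; exact le_self_add
    _ < (i + j) * (i + j) + (i + j) + (i + j + 1) :=
        lt_add_of_pos_right _ (add_pos_of_nonneg_of_pos zero_le one_pos)
    _ = (i + j + 1) * (i + j + 1) := by ring
    _ ≤ (i' + j') * (i' + j') := by gcongr
    _ ≤ _ := le_self_add

theorem pair_inj {i j i' j' : M} : pair i j = pair i' j' ↔ i = i' ∧ j = j' := by
  refine ⟨fun h => ?_, by rintro ⟨rfl, rfl⟩; rfl⟩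
  have hs : i + j = i' + j' := by
    rcases lt_trichotomy (i + j) (i' + j') with hlt | heq | hlt
    · exact absurd h (pair_lt_pair_of_add_lt hlt).ne
    · exact heq
    · exact absurd h (pair_lt_pair_of_add_lt hlt).ne'
  unfold pair at h
  rw [hs] at h
  have hi : i = i' := add_left_cancel h
  subst hi
  exact ⟨rfl, add_left_cancel hs⟩

theorem inCode_pair {b m n x : M} :
    InCode (pair b (pair m n)) x ↔ x < b ∧ (m * (x + 1) + 1) ∣ n := by
  constructor
  · rintro ⟨b', m', n', h, hx, q, hq⟩
    rw [pair_inj, pair_inj] at h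
    obtain ⟨rfl, rfl, rfl⟩ := h
    exact ⟨hx, q, hq⟩
  · rintro ⟨hx, q, hq⟩
    exact ⟨b, m, n, rfl, hx, q, hq⟩

/-- Elements of a coded set, and components of coded pairs, lie below the code; this turns
quantifiers over them into bounded ones. -/
theorem InCode.lt {c x : M} (h : InCode c x) : x < c := by
  obtain ⟨b, m, n, rfl, hx, -⟩ := h
  exact hx.trans_le (left_le_pair _ _)

theorem InCode.left_lt {c i j : M} (h : InCode c (pair i j)) : i < c :=
  (left_le_pair i j).trans_lt h.lt

theorem InCode.right_lt {c i j : M} (h : InCode c (pair i j)) : j < c :=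
  (right_le_pair i j).trans_lt h.lt

theorem IsFinSetCode.ext {c d : M} (hc : IsFinSetCode c) (hd : IsFinSetCode d)
    (h : ∀ x, InCode c x ↔ InCode d x) : c = d := by
  rcases lt_trichotomy c d with hlt | heq | hlt
  · exact (hd.2 c hlt hc.1 h).elim
  · exact heq
  · exact (hc.2 d hlt hd.1 fun x => (h x).symm).elim

/-- `M` has no subtraction; the difference is taken between the cofactors, which are comparable once
`d ≠ 0`. -/
theorem dvd_of_dvd_add_left {a b d : M} (h : d ∣ a + b) (hb : d ∣ b) : d ∣ a := by
  obtain ⟨p, hp⟩ := h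
  obtain ⟨q, rfl⟩ := hb
  rcases eq_or_ne d 0 with rfl | hd
  · rw [zero_mul, zero_mul, add_zero] at hp
    rw [hp]
  · have hqp : q ≤ p := by
      have : d * q ≤ d * p := by rw [← hp]; exact le_add_self
      exact le_of_mul_le_mul_left this (pos_iff_ne_zero.2 hd)
    obtain ⟨r, rfl⟩ := exists_add_of_le hqp
    refine ⟨r, ?_⟩
    have : a + d * q = d * r + d * q := by rw [hp]; ring
    exact add_right_cancel this

/-- The moduli `m (x + 1) + 1` are pairwise coprime when `m` is divisible by the differences. -/
theorem dvd_of_dvd_mul_modulus {b m n x y : M} (hm : ∀ j, j < b → j + 1 ∣ m) (hx : x < b)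
    (hy : y < b) (hxy : x ≠ y) (h : m * (x + 1) + 1 ∣ n * (m * (y + 1) + 1)) : m * (x + 1) + 1 ∣ n := by
  rcases lt_or_gt_of_ne hxy with hlt | hlt
  · obtain ⟨c, rfl⟩ := (lt_iff_exists_eq_add _ _).1 hlt
    obtain ⟨e, rfl⟩ := hm c ((lt_of_lt_of_le (lt_add_one c) le_add_self).trans hy)
    -- Modulo `m(x+1)+1` one has `m(x+1) ≡ -1`, hence `e(x+1)²(m(y+1)+1) ≡ 1` here and `≡ -1` when
    -- `y < x`. So `n` is recovered from the hypothesis multiplied by `e(x+1)²`, with all terms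
    -- arranged to be positive.
    refine dvd_of_dvd_add_left
      (b := ((c + 1) * e * (x + 1) + 1) * (e * (x + 1) * (x + (c + 1) + 1) * n)) ?_
      (dvd_mul_right _ _)
    have := (dvd_mul_right ((c + 1) * e * (x + 1) + 1) n).add
      (h.mul_left (e * (x + 1) * (x + 1)))
    convert this using 1
    ring
  · obtain ⟨c, rfl⟩ := (lt_iff_exists_eq_add _ _).1 hlt
    obtain ⟨e, rfl⟩ := hm c ((lt_of_lt_of_le (lt_add_one c) le_add_self).trans hx)
    refine dvd_of_dvd_add_left (h := ?_) (h.mul_left (e * (y + (c + 1) + 1) * (y + (c + 1) + 1)))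
    refine ⟨n + e * (y + (c + 1) + 1) * (y + 1) * n, ?_⟩
    ring

/-! ### Definability and existence of codes of finite sets. -/

section Definability

variable {S : Set (Set M)} [hS : Fact (IsModelRCA0 S)] {α : Type u} [Ctx M α]

instance IsDelta.dvd (f g : α → M) [IsFn S f] [IsFn S g] : IsDelta S (fun x => f x ∣ g x) := by
  refine IsDelta.comp₂ (P := fun a b => a ∣ b) ?_ f g
  refine (inferInstance : IsDelta S fun y : M × M => ∃ q, q ≤ y.2 ∧ y.2 = y.1 * q).congr
    fun ⟨a, b⟩ => ⟨?_, fun ⟨q, _, hq⟩ => ⟨q, hq⟩⟩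
  rintro ⟨q, hq⟩
  rcases eq_or_ne a 0 with rfl | ha
  -- A cofactor of `0` is arbitrary and might exceed the bound, so it is replaced by `0`.
  · exact ⟨0, zero_le, by rw [hq, zero_mul, zero_mul]⟩
  · refine ⟨q, ?_, hq⟩
    have h1 : 1 ≤ a := by
      rw [← zero_add (1 : M), add_one_le_iff_lt]; exact pos_iff_ne_zero.2 ha
    calc q = 1 * q := (one_mul q).symm
      _ ≤ a * q := by gcongr
      _ = b := hq.symm

instance IsDelta.inCode (f g : α → M) [IsFn S f] [IsFn S g] :
    IsDelta S (fun x => InCode (f x) (g x)) := by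
  refine IsDelta.comp₂ (P := fun a b => InCode a b) ?_ f g
  refine (inferInstance : IsDelta S fun y : M × M => ∃ b, b ≤ y.1 ∧ ∃ m, m ≤ y.1 ∧ ∃ n, n ≤ y.1 ∧
    y.1 = pair b (pair m n) ∧ y.2 < b ∧ (m * (y.2 + 1) + 1) ∣ n).congr fun ⟨c, x⟩ => ⟨?_, ?_⟩
  · rintro ⟨b, m, n, h, hx, hq⟩
    have h' : pair m n ≤ c := by
      have : c = _ := h
      rw [this]; exact right_le_pair _ _
    exact ⟨b, by have : c = _ := h; rw [this]; exact left_le_pair _ _, m,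
      (left_le_pair _ _).trans h', n, (right_le_pair _ _).trans h', h, hx, hq⟩
  · rintro ⟨b, _, m, _, n, _, h, hx, hq⟩
    exact ⟨b, m, n, h, hx, hq⟩

instance IsDelta.isTriple (f : α → M) [IsFn S f] : IsDelta S (fun x => IsTriple (f x)) := by
  refine IsDelta.comp₁ (P := fun a => IsTriple a) ?_ f
  refine (inferInstance : IsDelta S fun y : PUnit.{u + 1} × M => ∃ b, b ≤ y.2 ∧ ∃ m, m ≤ y.2 ∧
    ∃ n, n ≤ y.2 ∧ y.2 = pair b (pair m n)).congr fun ⟨_, c⟩ => ⟨?_, ?_⟩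
  · rintro ⟨b, m, n, h⟩
    have h' : pair m n ≤ c := by
      have : c = _ := h
      rw [this]; exact right_le_pair _ _
    exact ⟨b, by have : c = _ := h; rw [this]; exact left_le_pair _ _, m,
      (left_le_pair _ _).trans h', n, (right_le_pair _ _).trans h', h⟩
  · rintro ⟨b, _, m, _, n, _, h⟩
    exact ⟨b, m, n, h⟩

instance IsDelta.isFinSetCode (f : α → M) [IsFn S f] :
    IsDelta S (fun x => IsFinSetCode (f x)) := by
  refine IsDelta.comp₁ (P := fun a => IsFinSetCode a) ?_ f
  refine (inferInstance : IsDelta S fun y : PUnit.{u + 1} × M => IsTriple y.2 ∧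
    ∀ c', c' < y.2 → IsTriple c' → ¬ ∀ x, x < y.2 → (InCode c' x ↔ InCode y.2 x)).congr
    fun ⟨_, c⟩ => and_congr_right fun _ => forall₂_congr fun c' hc' => imp_congr_right fun _ =>
      not_congr ⟨fun h x _ => h x, fun h x => ?_⟩
  by_cases hx : x < c
  · exact h x hx
  · exact ⟨fun h' => (hx (h'.lt.trans hc')).elim, fun h' => (hx h'.lt).elim⟩

instance IsDelta.isSeq (f g : α → M) [IsFn S f] [IsFn S g] :
    IsDelta S (fun x => IsSeq (f x) (g x)) := by
  refine IsDelta.comp₂ (P := fun a b => IsSeq a b) ?_ f g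
  refine (inferInstance : IsDelta S fun y : M × M => IsFinSetCode y.1 ∧
    (∀ x, x < y.1 → InCode y.1 x → ∃ i, i ≤ x ∧ ∃ j, j ≤ x ∧ i < y.2 ∧ x = pair i j) ∧
    ∀ i, i < y.2 → ∃ j, j < y.1 ∧ InCode y.1 (pair i j) ∧
      ∀ j', j' < y.1 → InCode y.1 (pair i j') → j' = j).congr
    fun ⟨s, l⟩ => and_congr_right fun _ => and_congr ⟨fun h x _ hx => ?_, fun h x hx => ?_⟩
      (forall₂_congr fun i _ => ⟨?_, ?_⟩)
  · obtain ⟨i, j, hi, rfl⟩ := h x hx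
    exact ⟨i, left_le_pair _ _, j, right_le_pair _ _, hi, rfl⟩
  · obtain ⟨i, _, j, _, hi, hx⟩ := h x hx.lt hx
    exact ⟨i, j, hi, hx⟩
  · rintro ⟨j, hj, hu⟩
    exact ⟨j, InCode.right_lt hj, hj, fun j' _ h => hu j' h⟩
  · rintro ⟨j, _, hj, hu⟩
    exact ⟨j, hj, fun j' h => hu j' (InCode.right_lt h) h⟩

/-- Replaces factorials and products, which are not available before recursion. It is used twice:
for the multiplier `m`, then for a common multiple `N` of the moduli. -/
theorem exists_common_multiple (F : M → M) (hpos : ∀ x, 0 < F x) (b : M)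
    (hF : IsFn S (fun y : PUnit.{u + 1} × M => F y.2) := by infer_instance) :
    ∃ N, 0 < N ∧ ∀ x, x < b → F x ∣ N := by
  have (f : (((PUnit.{u + 1} × M) × M) × M) → M) [IsFn S f] : IsFn S (fun y => F (f y)) :=
    hF.comp₁ f
  refine sigma_induction (S := S) (fun b => ∃ N, 0 < N ∧ ∀ x, x < b → F x ∣ N)
    ⟨1, one_pos, fun x hx => absurd hx not_lt_zero⟩ ?_ b
  rintro b ⟨N, hN, h⟩
  refine ⟨N * F b, mul_pos hN (hpos b), fun x hx => ?_⟩
  rcases (lt_add_one_iff_le.1 hx).lt_or_eq with hx | rfl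
  · exact (h x hx).mul_right _
  · exact Dvd.intro_left _ rfl

theorem exists_finSetCode (S : Set (Set M)) [Fact (IsModelRCA0 S)] {c₀ : M} (h₀ : IsTriple c₀) :
    ∃ c, c ≤ c₀ ∧ IsFinSetCode c ∧ ∀ x, InCode c x ↔ InCode c₀ x := by
  obtain ⟨c, ⟨hc, hce⟩, hmin⟩ := exists_least (S := S)
    (fun c => IsTriple c ∧ ∀ x, x < c₀ → (InCode c x ↔ InCode c₀ x)) ⟨h₀, fun _ _ => Iff.rfl⟩
  have hle : c ≤ c₀ := not_lt.1 fun hlt => hmin c₀ hlt ⟨h₀, fun _ _ => Iff.rfl⟩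
  have hce' : ∀ x, InCode c x ↔ InCode c₀ x := fun x =>
    ⟨fun h => (hce x (h.lt.trans_le hle)).1 h, fun h => (hce x h.lt).2 h⟩
  exact ⟨c, hle, ⟨hc, fun c' hc' ht h => hmin c' hc' ⟨ht, fun x _ => (h x).trans (hce' x)⟩⟩, hce'⟩

/-- `B` comes from moduli that can code all subsets of `{0, …, b - 1}`. -/
def IsCodeBound (b B : M) : Prop :=
  ∃ m, m < B ∧ ∃ N, N < B ∧ B = pair b (pair m N) + 1 ∧ 0 < m ∧ 0 < N ∧
    (∀ j, j < b → j + 1 ∣ m) ∧ ∀ x, x < b → m * (x + 1) + 1 ∣ N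

/-- Lets the bound be quantified inside the `Σ⁰₁` step relation of the generic construction. -/
instance IsDelta.isCodeBound (f g : α → M) [IsFn S f] [IsFn S g] :
    IsDelta S (fun x => IsCodeBound (f x) (g x)) := by
  refine IsDelta.comp₂ (P := fun a b => IsCodeBound a b) ?_ f g
  unfold IsCodeBound
  infer_instance

theorem exists_isCodeBound (S : Set (Set M)) [Fact (IsModelRCA0 S)] (b : M) :
    ∃ B, IsCodeBound b B := by
  obtain ⟨m, hm, hmd⟩ := exists_common_multiple (S := S) (fun x => x + 1)
    (fun x => add_pos_of_nonneg_of_pos zero_le one_pos) b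
  obtain ⟨N, hN, hNd⟩ := exists_common_multiple (S := S) (fun x => m * (x + 1) + 1)
    (fun x => add_pos_of_nonneg_of_pos zero_le one_pos) b
  have h := right_le_pair b (pair m N)
  exact ⟨pair b (pair m N) + 1, m, lt_add_one_iff_le.2 ((left_le_pair _ _).trans h), N,
    lt_add_one_iff_le.2 ((right_le_pair _ _).trans h), rfl, hm, hN, hmd, hNd⟩

/-- Every `Δ⁰₁` subset of `{0, …, b - 1}` has a code below a bound that depends only on `b`. -/
theorem IsCodeBound.exists_code {b B : M} (hB : IsCodeBound b B) {P : M → Prop}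
    (hP : IsDelta S (fun y : PUnit.{u + 1} × M => P y.2)) :
    ∃ c, c < B ∧ IsFinSetCode c ∧ ∀ x, InCode c x ↔ x < b ∧ P x := by
  obtain ⟨m, -, N, -, rfl, hm, hN, hmd, hNd⟩ := hB
  have hP' {β : Type u} [Ctx M β] (f : β → M) [IsFn S f] : IsDelta S (fun y => P (f y)) :=
    hP.comp₁ f
  -- `N` is split as `n * r`: among the moduli, `n` is divisible exactly by those of the `x < c`
  -- with `P x`, while `r` keeps those of all `x ≥ c`. Being a divisor of `N` bounds `n`
  -- independently of `P`.
  have key := sigma_induction (S := S) (fun c => c ≤ b → ∃ n r, n * r = N ∧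
      (∀ x, x < b → (m * (x + 1) + 1 ∣ n ↔ x < c ∧ P x)) ∧
      ∀ x, x < b → c ≤ x → m * (x + 1) + 1 ∣ r)
    (fun _ => ⟨1, N, one_mul N, fun x _ => ⟨fun h => ?_, fun h => absurd h.1 not_lt_zero⟩,
      fun x hx _ => hNd x hx⟩) (fun c ih hc => ?_) b
  · obtain ⟨n, r, hnr, hn, -⟩ := key le_rfl
    have hex : IsTriple (pair b (pair m n)) ∧
        ∀ x, InCode (pair b (pair m n)) x ↔ x < b ∧ P x := by
      refine ⟨⟨_, _, _, rfl⟩, fun x => ?_⟩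
      rw [inCode_pair]
      exact ⟨fun h => ⟨h.1, ((hn x h.1).1 h.2).2⟩, fun h => ⟨h.1, (hn x h.1).2 h⟩⟩
    obtain ⟨c, hc, hfc, hce⟩ := exists_finSetCode S hex.1
    refine ⟨c, lt_add_one_iff_le.2 (hc.trans ?_), hfc, fun x => (hce x).trans (hex.2 x)⟩
    have hr : 1 ≤ r := by
      rw [← zero_add (1 : M), add_one_le_iff_lt, pos_iff_ne_zero]
      rintro rfl
      rw [mul_zero] at hnr
      exact hN.ne hnr
    have hnN : n ≤ N := by
      calc n = n * 1 := (mul_one n).symm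
        _ ≤ n * r := by gcongr
        _ = N := hnr
    unfold pair
    gcongr
  · obtain ⟨q, hq⟩ := h
    exfalso
    have h1 : 1 < m * (x + 1) + 1 := by
      have : 0 < m * (x + 1) := mul_pos hm (add_pos_of_nonneg_of_pos zero_le one_pos)
      grind
    rcases eq_or_ne q 0 with rfl | h0
    · rw [mul_zero] at hq
      exact one_ne_zero hq
    · have : 1 ≤ q := by
        rw [← zero_add (1 : M), add_one_le_iff_lt]; exact pos_iff_ne_zero.2 h0
      have : (1 : M) < 1 := calc
        (1 : M) < m * (x + 1) + 1 := h1
        _ = (m * (x + 1) + 1) * 1 := (mul_one _).symm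
        _ ≤ (m * (x + 1) + 1) * q := by gcongr
        _ = 1 := hq.symm
      exact lt_irrefl _ this
  · have hcb : c < b := add_one_le_iff_lt.1 hc
    obtain ⟨n, r, hnr, hn, hr⟩ := ih hcb.le
    by_cases hPc : P c
    · obtain ⟨r', rfl⟩ := hr c hcb le_rfl
      -- The modulus of `c` moves from `r` to `n`; by coprimality the divisibility by the other
      -- moduli is unaffected.
      refine ⟨n * (m * (c + 1) + 1), r', by rw [← hnr]; ring, fun x hx => ?_, fun x hx hcx => ?_⟩
      · rcases eq_or_ne x c with rfl | hxc
        · exact ⟨fun _ => ⟨lt_add_one x, hPc⟩, fun _ => dvd_mul_left _ _⟩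
        · have : m * (x + 1) + 1 ∣ n * (m * (c + 1) + 1) ↔ m * (x + 1) + 1 ∣ n :=
            ⟨dvd_of_dvd_mul_modulus hmd hx hcb hxc, fun h => h.mul_right _⟩
          rw [this, hn x hx, lt_add_one_iff_le, le_iff_lt_or_eq]
          simp [hxc]
      · have hcx' : c < x := add_one_le_iff_lt.1 hcx
        refine dvd_of_dvd_mul_modulus hmd hx hcb hcx'.ne' ?_
        rw [mul_comm r']
        exact hr x hx hcx'.le
    · refine ⟨n, r, hnr, fun x hx => ?_, fun x hx hcx => hr x hx ((lt_add_one c).le.trans hcx)⟩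
      rw [hn x hx, lt_add_one_iff_le, le_iff_lt_or_eq]
      constructor
      · exact fun h => ⟨Or.inl h.1, h.2⟩
      · rintro ⟨h | rfl, h'⟩
        · exact ⟨h, h'⟩
        · exact absurd h' hPc

end Definability

end Coding

/-! ### Finite sequences and recursion -/

section Sequences

variable {M : Type u} [NumStructure M]

theorem IsSeq.exists_value {s l i : M} (h : IsSeq s l) (hi : i < l) : ∃ j, InCode s (pair i j) :=
  (h.2.2 i hi).exists

theorem IsSeq.forall_inCode {s l : M} (hs : IsSeq s l) {P : M → Prop}
    (h : ∀ i j, InCode s (pair i j) → P (pair i j)) (x : M) (hx : InCode s x) : P x := by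
  obtain ⟨i, j, -, rfl⟩ := hs.2.1 x hx
  exact h i j hx

variable [DiscreteArith M]

theorem IsSeq.lt_length {s l i j : M} (h : IsSeq s l) (hij : InCode s (pair i j)) : i < l := by
  obtain ⟨i', j', hi, he⟩ := h.2.1 _ hij
  rw [pair_inj] at he
  exact he.1 ▸ hi

theorem IsSeq.value_unique {s l i j j' : M} (h : IsSeq s l) (hj : InCode s (pair i j))
    (hj' : InCode s (pair i j')) : j = j' :=
  (h.2.2 i (h.lt_length hj)).unique hj hj'

theorem IsSeq.length_le {s l : M} (h : IsSeq s l) : l ≤ s := by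
  rw [← not_lt]
  intro hlt
  obtain ⟨j, hj⟩ := h.exists_value hlt
  exact lt_irrefl _ hj.left_lt

theorem IsSeq.length_le_of_subset {s t l m : M} (hs : IsSeq s l) (ht : IsSeq t m)
    (h : ∀ x, InCode s x → InCode t x) : l ≤ m := by
  rw [← not_lt]
  intro hlt
  obtain ⟨j, hj⟩ := hs.exists_value hlt
  exact lt_irrefl _ (ht.lt_length (h _ hj))

theorem IsSeq.length_unique {s l m : M} (hs : IsSeq s l) (ht : IsSeq s m) : l = m :=
  le_antisymm (hs.length_le_of_subset ht fun _ h => h) (ht.length_le_of_subset hs fun _ h => h)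

theorem IsSeq.subset_of_prefix {s t l m : M} (hs : IsSeq s l) (ht : IsSeq t m) {X : Set M}
    (hX : ∀ i j j', pair i j ∈ X → pair i j' ∈ X → j = j') (hsX : IsPrefix s X)
    (htX : IsPrefix t X) (hlm : l ≤ m) (x : M) (hx : InCode s x) : InCode t x := by
  refine hs.forall_inCode (P := fun x => InCode t x) (fun i j hij => ?_) x hx
  obtain ⟨j', hj'⟩ := ht.exists_value ((hs.lt_length hij).trans_le hlm)
  rwa [hX i j j' (hsX _ hij) (htX _ hj')]

variable {S : Set (Set M)} [hS : Fact (IsModelRCA0 S)]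

theorem exists_bound (F : M → M) (l : M)
    (hF : IsFn S (fun y : PUnit.{u + 1} × M => F y.2) := by infer_instance) :
    ∃ B, ∀ i, i < l → F i < B := by
  have (f : (((PUnit.{u + 1} × M) × M) × M) → M) [IsFn S f] : IsFn S (fun y => F (f y)) :=
    hF.comp₁ f
  refine sigma_induction (S := S) (fun l => ∃ B, ∀ i, i < l → F i < B)
    ⟨0, fun i hi => absurd hi not_lt_zero⟩ ?_ l
  rintro n ⟨B, hB⟩
  refine ⟨max B (F n + 1), fun i hi => ?_⟩
  rcases (lt_add_one_iff_le.1 hi).lt_or_eq with hi | rfl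
  · exact (hB i hi).trans_le (le_max_left _ _)
  · exact (lt_add_one _).trans_le (le_max_right _ _)

/-- `F` is bounded by some `B` below `l`, so its graph there is a `Δ⁰₁` set of numbers below `pair l
B`, which has a code. -/
theorem exists_seq (F : M → M) (l : M)
    (hF : IsFn S (fun y : PUnit.{u + 1} × M => F y.2) := by infer_instance) :
    ∃ s, IsSeq s l ∧ ∀ i j, InCode s (pair i j) ↔ i < l ∧ j = F i := by
  have {β : Type u} [Ctx M β] (f : β → M) [IsFn S f] : IsFn S (fun y => F (f y)) := hF.comp₁ f
  obtain ⟨B, hB⟩ := exists_bound (S := S) F l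
  obtain ⟨_, hN⟩ := exists_isCodeBound S (pair l B)
  obtain ⟨s, -, hs, hse⟩ := hN.exists_code (S := S)
    (P := fun x => ∃ i, i ≤ x ∧ i < l ∧ x = pair i (F i)) inferInstance
  have key : ∀ i j, InCode s (pair i j) ↔ i < l ∧ j = F i := fun i j => by
    rw [hse]
    constructor
    · rintro ⟨-, i', -, hi', he⟩
      rw [pair_inj] at he
      obtain ⟨rfl, rfl⟩ := he
      exact ⟨hi', rfl⟩
    · rintro ⟨hi, rfl⟩
      exact ⟨pair_lt_pair_of_add_lt (add_lt_add hi (hB i hi)), i, left_le_pair _ _, hi, rfl⟩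
  refine ⟨s, ⟨hs, fun x hx => ?_, fun i hi => ⟨F i, (key i _).2 ⟨hi, rfl⟩, fun j hj => ?_⟩⟩, key⟩
  · obtain ⟨-, i, -, hi, he⟩ := (hse x).1 hx
    exact ⟨i, F i, hi, he⟩
  · exact ((key i j).1 hj).2

/-- Finite choice for `Σ⁰₁` relations. -/
theorem exists_seq_of_forall_exists (R : M → M → Prop) {l : M} (h : ∀ i, i < l → ∃ j, R i j)
    (hR : IsSigma S (fun y : M × M => R y.1 y.2) := by infer_instance) :
    ∃ s, IsSeq s l ∧ ∀ i j, InCode s (pair i j) → R i j := by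
  have {β : Type u} [Ctx M β] (f g : β → M) [IsFn S f] [IsFn S g] :
    IsSigma S (fun y => R (f y) (g y)) := hR.comp₂ f g
  obtain ⟨F, hF, hFR⟩ := exists_selector (S := S) (α := PUnit.{u + 1} × M)
    -- The selector needs a total relation; beyond `l` any value is allowed.
    (fun x j => x.2 < l → R x.2 j) (fun x => by
      by_cases hx : x.2 < l
      · obtain ⟨j, hj⟩ := h x.2 hx
        exact ⟨j, fun _ => hj⟩
      · exact ⟨0, fun h => (hx h).elim⟩)
  obtain ⟨s, hs, hse⟩ := exists_seq (S := S) (fun i => F (PUnit.unit, i)) l hF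
  refine ⟨s, hs, fun i j hij => ?_⟩
  obtain ⟨hi, rfl⟩ := (hse i j).1 hij
  exact hFR (PUnit.unit, i) hi

/-- Primitive recursion. -/
theorem exists_recursion (a : M) (h : M → M → M) (hh : IsFn S (fun y : M × M => h y.1 y.2)) :
    ∃ F : M → M, IsFn S (fun y : PUnit.{u + 1} × M => F y.2) ∧ F 0 = a ∧
      ∀ n, F (n + 1) = h n (F n) := by
  have {β : Type u} [Ctx M β] (f g : β → M) [IsFn S f] [IsFn S g] :
    IsFn S (fun y => h (f y) (g y)) := hh.comp₂ f g
  -- `T n c`: `c` records the computation of the values at `0, …, n`. Existence is a `Σ⁰₁`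
  -- induction; uniqueness of values is a `Δ⁰₁` one because the values are bounded by the codes.
  let T (n c : M) : Prop := IsSeq c (n + 1) ∧ InCode c (pair 0 a) ∧
    ∀ i, i < n → ∀ u, u < c → InCode c (pair i u) → InCode c (pair (i + 1) (h i u))
  have hT {β : Type u} [Ctx M β] (f g : β → M) [IsFn S f] [IsFn S g] :
      IsDelta S (fun y => T (f y) (g y)) := by
    refine IsDelta.comp₂ (P := T) ?_ f g
    change IsDelta S (fun y : M × M => IsSeq y.2 (y.1 + 1) ∧ InCode y.2 (pair 0 a) ∧
      ∀ i, i < y.1 → ∀ u, u < y.2 → InCode y.2 (pair i u) → InCode y.2 (pair (i + 1) (h i u)))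
    infer_instance
  have hex : ∀ n, ∃ c, T n c := by
    refine fun n => sigma_induction (S := S) (fun n => ∃ c, T n c) ?_ ?_ n
    · obtain ⟨c, hc, hca⟩ := exists_seq (S := S) (fun _ => a) (0 + 1)
      exact ⟨c, hc, (hca _ _).2 ⟨lt_add_one 0, rfl⟩, fun i hi => absurd hi not_lt_zero⟩
    · rintro n ⟨c, hc, hca, hcs⟩
      obtain ⟨d, hd, hdR⟩ := exists_seq_of_forall_exists (S := S) (l := n + 1 + 1)
        (fun i j => InCode c (pair i j) ∨
          (i = n + 1 ∧ ∃ u, u < c ∧ InCode c (pair n u) ∧ j = h n u)) (fun i hi => by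
          rcases (lt_add_one_iff_le.1 hi).lt_or_eq with hi | rfl
          · obtain ⟨j, hj⟩ := hc.exists_value hi
            exact ⟨j, Or.inl hj⟩
          · obtain ⟨u, hu⟩ := hc.exists_value (lt_add_one n)
            exact ⟨h n u, Or.inr ⟨rfl, u, hu.right_lt, hu, rfl⟩⟩)
      have hcd : ∀ i j, InCode c (pair i j) → InCode d (pair i j) := fun i j hij => by
        have hi := hc.lt_length hij
        obtain ⟨j', hj'⟩ := hd.exists_value (hi.trans (lt_add_one _))
        rcases hdR i j' hj' with h' | ⟨rfl, -⟩
        · rwa [hc.value_unique hij h']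
        · exact absurd hi (lt_irrefl _)
      refine ⟨d, hd, hcd _ _ hca, fun i hi u _ hiu => ?_⟩
      have hiu' : InCode c (pair i u) := by
        obtain ⟨u', hu'⟩ := hc.exists_value hi
        rwa [hd.value_unique hiu (hcd _ _ hu')]
      rcases (lt_add_one_iff_le.1 hi).lt_or_eq with hi | rfl
      · exact hcd _ _ (hcs i hi u hiu'.right_lt hiu')
      · obtain ⟨j, hj⟩ := hd.exists_value (lt_add_one (i + 1))
        rcases hdR _ j hj with h' | ⟨-, v, -, hv, rfl⟩
        · exact absurd (hc.lt_length h') (lt_irrefl _)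
        · rwa [hc.value_unique hiu' hv]
  have huniq {n c m d : M} (hc : T n c) (hd : T m d) (i : M) : ∀ u, u < c → ∀ v, v < d →
      InCode c (pair i u) → InCode d (pair i v) → u = v := by
    refine delta_induction (S := S) (fun i => ∀ u, u < c → ∀ v, v < d →
      InCode c (pair i u) → InCode d (pair i v) → u = v) ?_ ?_ i
    · intro u _ v _ hu hv
      rw [hc.1.value_unique hu hc.2.1, hd.1.value_unique hv hd.2.1]
    · intro i ih u _ v _ hu hv
      have hin := hc.1.lt_length hu
      have him := hd.1.lt_length hv
      obtain ⟨u', hu'⟩ := hc.1.exists_value ((lt_add_one i).trans hin)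
      obtain ⟨v', hv'⟩ := hd.1.exists_value ((lt_add_one i).trans him)
      have h1 := hc.2.2 i (lt_of_add_lt_add_right hin) u' hu'.right_lt hu'
      have h2 := hd.2.2 i (lt_of_add_lt_add_right him) v' hv'.right_lt hv'
      rw [hc.1.value_unique hu h1, hd.1.value_unique hv h2,
        ih u' hu'.right_lt v' hv'.right_lt hu' hv']
  choose c hc using hex
  choose F hF using fun n => (hc n).1.exists_value (lt_add_one n)
  refine ⟨F, ⟨?_⟩, (hc 0).1.value_unique (hF 0) (hc 0).2.1, fun n => ?_⟩
  · refine (inferInstance : IsSigma S (fun y : (PUnit.{u + 1} × M) × M =>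
      ∃ c, T y.1.2 c ∧ InCode c (pair y.1.2 y.2))).congr fun ⟨⟨_, n⟩, v⟩ => ?_
    constructor
    · intro hv
      have hv' : v = F n := hv
      subst hv'
      exact ⟨c n, hc n, hF n⟩
    · rintro ⟨d, hd, hv⟩
      exact huniq hd (hc n) n v hv.right_lt _ (hF n).right_lt hv (hF n)
  · obtain ⟨u, hu⟩ := (hc (n + 1)).1.exists_value ((lt_add_one n).trans (lt_add_one _))
    have h1 := (hc (n + 1)).2.2 n (lt_add_one n) u hu.right_lt hu
    rw [(hc (n + 1)).1.value_unique (hF (n + 1)) h1,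
      huniq (hc n) (hc (n + 1)) n _ (hF n).right_lt u hu.right_lt (hF n) hu]

/-- Dependent choice for `Σ⁰₁` relations. -/
theorem exists_dependent_choice (V : M → M → Prop) (R : M → M → M → Prop) {a : M} (h0 : V 0 a)
    (h1 : ∀ n y, V n y → ∃ z, V (n + 1) z ∧ R n y z)
    (hV : IsDelta S (fun y : M × M => V y.1 y.2))
    (hR : IsSigma S (fun y : (M × M) × M => R y.1.1 y.1.2 y.2)) :
    ∃ F : M → M, IsFn S (fun y : PUnit.{u + 1} × M => F y.2) ∧ (∀ n, V n (F n)) ∧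
      ∀ n, R n (F n) (F (n + 1)) := by
  have {β : Type u} [Ctx M β] (f g : β → M) [IsFn S f] [IsFn S g] :
    IsDelta S (fun y => V (f y) (g y)) := hV.comp₂ f g
  obtain ⟨h, hh, hhR⟩ := exists_selector (S := S) (α := M × M)
    -- `V` occurs as a premise, which is why it must be `Δ⁰₁` while `R` may be `Σ⁰₁`.
    (fun x z => V x.1 x.2 → V (x.1 + 1) z ∧ R x.1 x.2 z) (fun x => by
      by_cases hx : V x.1 x.2
      · obtain ⟨z, hz⟩ := h1 _ _ hx
        exact ⟨z, fun _ => hz⟩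
      · exact ⟨0, fun h => (hx h).elim⟩)
  obtain ⟨F, hF, hF0, hFs⟩ := exists_recursion (S := S) a (fun n y => h (n, y)) hh
  have {β : Type u} [Ctx M β] (f : β → M) [IsFn S f] : IsFn S (fun y => F (f y)) := hF.comp₁ f
  have hVF : ∀ n, V n (F n) := fun n => delta_induction (S := S) (fun n => V n (F n)) (hF0 ▸ h0)
    (fun n hn => by rw [hFs]; exact (hhR (n, F n) hn).1) n
  exact ⟨F, hF, hVF, fun n => by rw [hFs]; exact (hhR (n, F n) (hVF n)).2⟩

end Sequences

/-! ### Ordered strings and partitions -/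

section Partitions

variable {M : Type u} [NumStructure M]

/-- `y` codes an ordered finite sequence whose set of values is `{0, …, b - 1}`. -/
def IsOrderedSeq (b y : M) : Prop :=
  (∃ l, IsSeq y l) ∧ (∀ n i, InCode y (pair n i) → i < b) ∧ IsOrdered {x | InCode y x} ∧
    ∀ i, i < b → ∃ n, InCode y (pair n i)

/-- Inclusion of coded finite sets. -/
def CodeSubset (s t : M) : Prop := ∀ x, InCode s x → InCode t x

/-- The number of values in `IsOrderedSeq` may be nonstandard, as the strings approximating an
infinite partition require. -/
theorem isFinPartition_iff {k : ℕ} {s : M} : IsFinPartition k s ↔ IsOrderedSeq (numeral M k) s :=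
  Iff.rfl

theorem IsFun.exists_value {f : Set M} (hf : IsFun f) (i : M) : ∃ j, pair i j ∈ f :=
  (hf.2 i).exists

theorem IsFun.value_unique {f : Set M} (hf : IsFun f) {i j j' : M} (h : pair i j ∈ f)
    (h' : pair i j' ∈ f) : j = j' :=
  (hf.2 i).unique h h'

theorem numeral_pred_add_one {k : ℕ} (hk : 2 ≤ k) : numeral M k = numeral M (k - 1) + 1 := by
  obtain ⟨k, rfl⟩ := Nat.exists_eq_add_of_le hk
  rw [Nat.add_comm]
  rfl

variable [DiscreteArith M]

theorem IsRestriction.inCode_iff {x : Set M} (hx : IsFun x) {l s : M} (hs : IsRestriction x l s)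
    {i j : M} : InCode s (pair i j) ↔ i < l ∧ pair i j ∈ x := by
  refine ⟨fun h => ⟨hs.1.lt_length h, hs.2 _ h⟩, fun ⟨hi, hij⟩ => ?_⟩
  obtain ⟨j', hj'⟩ := hs.1.exists_value hi
  rwa [hx.value_unique hij (hs.2 _ hj')]

theorem IsRestriction.isOrderedSeq {x : Set M} (hx : IsFun x) (ho : IsOrdered x) {l s b : M}
    (hs : IsRestriction x l s) (hlt : ∀ n i, n < l → pair n i ∈ x → i < b)
    (hsurj : ∀ i, i < b → ∃ n, n < l ∧ pair n i ∈ x) : IsOrderedSeq b s := by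
  refine ⟨⟨l, hs.1⟩, fun n i h => ?_, fun n i h j hj => ?_, fun i hi => ?_⟩
  · rw [hs.inCode_iff hx] at h
    exact hlt n i h.1 h.2
  · have h' := (hs.inCode_iff hx).1 h
    obtain ⟨m, hm, hmj⟩ := ho n i h'.2 j hj
    exact ⟨m, hm, (hs.inCode_iff hx).2 ⟨hm.trans h'.1, hmj⟩⟩
  · obtain ⟨n, hn, h⟩ := hsurj i hi
    exact ⟨n, (hs.inCode_iff hx).2 ⟨hn, h⟩⟩

section Definability

variable {S : Set (Set M)} [hS : Fact (IsModelRCA0 S)] {α : Type u} [Ctx M α]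

instance IsDelta.isOrderedSeq (f g : α → M) [IsFn S f] [IsFn S g] :
    IsDelta S (fun x => IsOrderedSeq (f x) (g x)) := by
  refine IsDelta.comp₂ (P := fun a b => IsOrderedSeq a b) ?_ f g
  refine (inferInstance : IsDelta S fun y : M × M => (∃ l, l ≤ y.2 ∧ IsSeq y.2 l) ∧
    (∀ n, n < y.2 → ∀ i, i < y.2 → InCode y.2 (pair n i) → i < y.1) ∧
    (∀ n, n < y.2 → ∀ i, i < y.2 → InCode y.2 (pair n i) → ∀ j, j < i → ∃ m, m < n ∧
      InCode y.2 (pair m j)) ∧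
    ∀ i, i < y.1 → ∃ n, n < y.2 ∧ InCode y.2 (pair n i)).congr fun ⟨b, y⟩ => ?_
  refine and_congr ⟨fun ⟨l, h⟩ => ⟨l, h.length_le, h⟩, fun ⟨l, _, h⟩ => ⟨l, h⟩⟩
    (and_congr ⟨fun h n _ i _ => h n i, fun h n i hni => h n hni.left_lt i hni.right_lt hni⟩
    (and_congr ⟨fun h n _ i _ => h n i, fun h n i hni => h n (InCode.left_lt hni) i
      (InCode.right_lt hni) hni⟩ (forall₂_congr fun i _ => ⟨fun ⟨n, h⟩ => ⟨n, h.left_lt, h⟩,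
        fun ⟨n, _, h⟩ => ⟨n, h⟩⟩)))

instance IsDelta.codeSubset (f g : α → M) [IsFn S f] [IsFn S g] :
    IsDelta S (fun x => CodeSubset (f x) (g x)) := by
  refine IsDelta.comp₂ (P := fun a b => CodeSubset a b) ?_ f g
  exact (inferInstance : IsDelta S fun y : M × M => ∀ x, x < y.1 → InCode y.1 x →
    InCode y.2 x).congr fun ⟨a, b⟩ => ⟨fun h x _ hx => h x hx, fun h x hx => h x hx.lt hx⟩

/-- A `Σ⁰₁` graph of a total function is a set of the model. -/
theorem exists_graph (R : M → M → Prop) (hR : ∀ n, ∃! a, R n a)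
    (h : IsSigma S (fun y : M × M => R y.1 y.2) := by infer_instance) :
    ∃ f ∈ S, IsFun f ∧ ∀ n a, pair n a ∈ f ↔ R n a := by
  have h1 {β : Type u} [Ctx M β] (f g : β → M) [IsFn S f] [IsFn S g] :
    IsSigma S (fun y => R (f y) (g y)) := h.comp₂ f g
  have h2 {β : Type u} [Ctx M β] (f g : β → M) [IsFn S f] [IsFn S g] :
      IsDelta S (fun y => R (f y) (g y)) := by
    refine IsDelta.comp₂ (P := R) ⟨h, ?_⟩ f g
    -- By totality and uniqueness, `R n a` fails exactly when another value is taken, so the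
    -- complement is also `Σ⁰₁`.
    refine (inferInstance : IsSigma S fun y : M × M => ∃ a, R y.1 a ∧ a ≠ y.2).congr
      fun ⟨n, a⟩ => ⟨fun hna => ?_, fun ⟨b, hb, hne⟩ ha => hne ((hR n).unique hb ha)⟩
    obtain ⟨b, hb⟩ := (hR n).exists
    exact ⟨b, hb, fun hba => hna (hba ▸ hb)⟩
  have key : ∀ n a, pair n a ∈ {z | ∃ n, n ≤ z ∧ ∃ a, a ≤ z ∧ z = pair n a ∧ R n a} ↔ R n a := by
    intro n a
    constructor
    · rintro ⟨n', -, a', -, he, h⟩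
      rw [pair_inj] at he
      rwa [he.1, he.2]
    · exact fun h => ⟨n, left_le_pair _ _, a, right_le_pair _ _, rfl, h⟩
  refine ⟨_, delta_comprehension (S := S) (fun z => ∃ n, n ≤ z ∧ ∃ a, a ≤ z ∧ z = pair n a ∧ R n a),
    ⟨fun x hx => ?_, fun n => ?_⟩, key⟩
  · obtain ⟨n, -, a, -, he, -⟩ := hx
    exact ⟨n, a, he⟩
  · simp only [key]
    exact hR n

theorem exists_restriction {x : Set M} (hxS : x ∈ S) (hx : IsFun x) (l : M) :
    ∃ s, IsRestriction x l s := by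
  have := Fact.mk hxS
  obtain ⟨s, hs, h⟩ := exists_seq_of_forall_exists (S := S) (fun i j => pair i j ∈ x)
    (fun i (_ : i < l) => hx.exists_value i)
  exact ⟨s, hs, fun z hz => hs.forall_inCode (P := (· ∈ x)) h z hz⟩

end Definability

theorem numeral_pred_pos {k : ℕ} (hk : 2 ≤ k) : 0 < numeral M (k - 1) := by
  obtain ⟨k, rfl⟩ := Nat.exists_eq_add_of_le hk
  rw [Nat.add_comm]
  exact add_pos_of_nonneg_of_pos zero_le one_pos

/-! ### From Baire colorings to open colorings -/

variable {S : Set (Set M)}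

/-- All `D_n` are taken to be the union of the colors. It is dense because a string `t` padded with
zeros is a partition, hence has a color, and the string witnessing this is comparable with `t`. -/
theorem BaireDRT.odrt [hS : Fact (IsModelRCA0 S)] {k ℓ : ℕ} (hk : 2 ≤ k) (h : BaireDRT S k ℓ) :
    ODRT S k ℓ := by
  intro O hOS hO
  have (i : Fin ℓ) := Fact.mk (hOS i)
  let D : Set M := {z | ∃ i, i ≤ z ∧ ∃ w, w ≤ z ∧ z = pair i w ∧ ∃ j, w ∈ O j}
  have hD : D ∈ S := delta_comprehension (S := S) _
  have hsec : ∀ n, openSection D n = ⋃ i, O i := fun n => by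
    ext w
    rw [Set.mem_iUnion]
    constructor
    · rintro ⟨i, -, w', -, he, h⟩
      rw [pair_inj] at he
      rwa [he.2]
    · exact fun h => ⟨n, left_le_pair _ _, w, right_le_pair _ _, rfl, h⟩
  have hdense : IsDenseCode k (⋃ i, O i) := by
    rintro t ⟨⟨l, hl⟩, htlt, hto, hts⟩
    obtain ⟨x, hxS, hxf, hx⟩ := exists_graph (S := S)
      (fun n a => InCode t (pair n a) ∨ l ≤ n ∧ a = 0) (fun n => by
        rcases lt_or_ge n l with hn | hn
        · obtain ⟨j, hj⟩ := hl.exists_value hn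
          exact ⟨j, Or.inl hj, fun j' h => h.elim (fun h => hl.value_unique h hj)
            fun h => absurd hn h.1.not_gt⟩
        · exact ⟨0, Or.inr ⟨hn, rfl⟩, fun j' h => h.elim
            (fun h => absurd (hl.lt_length h) hn.not_gt) fun h => h.2⟩)
    have hxp : IsPartition k x := by
      refine ⟨hxf, fun n i hni => ?_, fun n i hni j hj => ?_, fun i hi => ?_⟩
      · rcases (hx n i).1 hni with h | ⟨-, rfl⟩
        · exact htlt n i h
        · rw [numeral_pred_add_one hk]
          exact add_pos_of_nonneg_of_pos zero_le one_pos
      · rcases (hx n i).1 hni with h | ⟨-, rfl⟩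
        · obtain ⟨m, hm, hmj⟩ := hto n i h j hj
          exact ⟨m, hm, (hx m j).2 (Or.inl hmj)⟩
        · exact absurd hj not_lt_zero
      · obtain ⟨n, hn⟩ := hts i hi
        exact ⟨n, (hx n i).2 (Or.inl hn)⟩
    obtain ⟨i, n, s, hns, hsx⟩ := hO.2 x hxS hxp
    refine ⟨n, s, Set.mem_iUnion.2 ⟨i, hns⟩, ?_⟩
    obtain ⟨n', s', he, ⟨⟨l', hl'⟩, -⟩⟩ := hO.1 i _ hns
    rw [pair_inj] at he
    rw [← he.2] at hl'
    have htx : IsPrefix t x := hl.forall_inCode (P := (· ∈ x)) fun i j h => (hx i j).2 (Or.inl h)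
    have hu : ∀ i j j', pair i j ∈ x → pair i j' ∈ x → j = j' := fun i j j' => hxf.value_unique
    rcases le_total l' l with hll | hll
    · exact Or.inl (hl'.subset_of_prefix hl hu hsx htx hll)
    · exact Or.inr (hl.subset_of_prefix hl' hu htx hsx hll)
  have hcol : IsBaireColoring k O D := by
    refine ⟨?_, fun n => (hsec n).symm ▸ hdense, hO.1, hdense⟩
    rintro z ⟨i, -, w, -, rfl, j, hj⟩
    obtain ⟨n, s, rfl, hs⟩ := hO.1 j w hj
    exact ⟨i, n, s, rfl, hs⟩
  obtain ⟨p, hpS, hp, i, hpi⟩ := h O D hOS hD hcol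
  exact ⟨p, hpS, hp, i, fun x hxS hx => (hpi x hxS hx).1⟩

/-! ### From open colorings to colorings of strings -/

theorem IsPartition.isFinPartition_restriction {k : ℕ} (hk : 2 ≤ k) {x : Set M}
    (hx : IsPartition k x) {m l s : M} (hm : pair m (numeral M (k - 1)) ∈ x) (hml : m < l)
    (hs : IsRestriction x l s) : IsFinPartition k s := by
  refine hs.isOrderedSeq hx.1 hx.2.2.1 (fun n i _ => hx.2.1 n i) fun i hi => ?_
  rw [numeral_pred_add_one hk, lt_add_one_iff_le] at hi
  rcases hi.lt_or_eq with hi | rfl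
  · obtain ⟨n, hn, h⟩ := hx.2.2.1 m _ hm i hi
    exact ⟨n, hn.trans hml, h⟩
  · exact ⟨m, hml, hm⟩

theorem IsPartition.isFinPartition_restriction_mu {k : ℕ} (hk : 2 ≤ k) {x : Set M}
    (hx : IsPartition k x) {m s : M} (hm : IsMu x (numeral M (k - 1)) m)
    (hs : IsRestriction x m s) : IsFinPartition (k - 1) s := by
  refine hs.isOrderedSeq hx.1 hx.2.2.1 (fun n i hn hni => ?_) fun i hi => hx.2.2.1 m _ hm.1 i hi
  have := hx.2.1 n i hni
  rw [numeral_pred_add_one hk, lt_add_one_iff_le] at this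
  exact this.lt_of_ne fun he => hm.2 n hn (he ▸ hni)

/-- The color of `x` is that of `x ↾ μ^x(k-1)`, which is decided by an initial segment of `x`
containing position `μ^x(k-1)`. -/
theorem ODRT.cdrt [hS : Fact (IsModelRCA0 S)] {k ℓ : ℕ} (hk : 2 ≤ k) (h : ODRT S k ℓ) :
    CDRT S k ℓ := by
  intro C hCS hC
  have (i : Fin ℓ) := Fact.mk (hCS i)
  -- The free number component of the code stores `t`, so the string that determines the color can
  -- be read off without a search.
  let O (c : Fin ℓ) : Set M := {z | ∃ t, t ≤ z ∧ ∃ s, s ≤ z ∧ z = pair t s ∧ t ∈ C c ∧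
    IsOrderedSeq (numeral M k) s ∧ ∃ l, l ≤ t ∧ IsSeq t l ∧ CodeSubset t s ∧
      InCode s (pair l (numeral M (k - 1)))}
  have hOS : ∀ c, O c ∈ S := fun c => delta_comprehension (S := S) _
  have hO : IsOpenColoring S k O := by
    refine ⟨?_, fun x hxS hx => ?_⟩
    · rintro c z ⟨t, -, s, -, rfl, -, hs, -⟩
      exact ⟨t, s, rfl, hs⟩
    · have := Fact.mk hxS
      obtain ⟨m₀, hm₀⟩ := hx.2.2.2 (numeral M (k - 1))
        (by rw [numeral_pred_add_one hk]; exact lt_add_one _)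
      obtain ⟨m, hm⟩ := exists_least (S := S) (fun m => pair m (numeral M (k - 1)) ∈ x) hm₀
      obtain ⟨t, ht⟩ := exists_restriction hxS hx.1 m
      obtain ⟨s, hs⟩ := exists_restriction hxS hx.1 (m + 1)
      obtain ⟨c, hc⟩ := hC.2 t (hx.isFinPartition_restriction_mu hk hm ht)
      refine ⟨c, t, s, ⟨t, left_le_pair _ _, s, right_le_pair _ _, rfl, hc,
        hx.isFinPartition_restriction hk hm.1 (lt_add_one m) hs, m, ht.1.length_le, ht.1, ?_, ?_⟩,
        hs.2⟩
      · exact ht.1.subset_of_prefix hs.1 (fun i j j' => hx.1.value_unique) ht.2 hs.2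
          (lt_add_one m).le
      · exact (hs.inCode_iff hx.1).2 ⟨lt_add_one m, hm.1⟩
  obtain ⟨p, hpS, hp, i, hpi⟩ := h O hOS hO
  refine ⟨p, hpS, hp, i, fun x hxS hx => ?_⟩
  obtain ⟨n, s, ⟨t, -, s', -, he, htC, hs, l, -, hl, hts, hls⟩, hsx⟩ := hpi x hxS hx
  rw [pair_inj] at he
  obtain ⟨rfl, rfl⟩ := he
  have htx : IsPrefix n x := fun y hy => hsx y (hts y hy)
  -- All values of the stored string are `< k - 1`, so the `k - 1` right after it is the first one
  -- in `x`.
  refine ⟨l, n, ⟨hsx _ hls, fun m hm hmx => ?_⟩, ⟨hl, htx⟩, htC⟩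
  obtain ⟨j, hj⟩ := hl.exists_value hm
  have := (hC.1 i n htC).2.1 m j hj
  rw [hx.1.1.value_unique (htx _ hj) hmx] at this
  exact lt_irrefl _ this

end Partitions

/-! ### From colorings of strings to Baire colorings -/

section Baire

variable {M : Type u} [NumStructure M]

/-- The string `s` is contained in the composition of the strings `g` and `y`. -/
def Fits (g y s : M) : Prop :=
  ∀ i j, InCode s (pair i j) → ∃ b, InCode y (pair i b) ∧ InCode g (pair b j)

/-- The composition of `g` and `y` extends a string from the `n`-th open set coded by `E`. -/
def Meets (E : Set M) (n g y : M) : Prop := ∃ m s, pair n (pair m s) ∈ E ∧ Fits g y s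

theorem Fits.mono {g y y' s : M} (h : Fits g y s) (hy : CodeSubset y y') : Fits g y' s :=
  fun i j hij => by
    obtain ⟨b, hb, hbj⟩ := h i j hij
    exact ⟨b, hy _ hb, hbj⟩

/-- Requirements stay met under extension, so they can be treated one after another. -/
theorem Meets.mono {E : Set M} {n g y y' : M} (h : Meets E n g y) (hy : CodeSubset y y') :
    Meets E n g y' := by
  obtain ⟨m, s, hms, hs⟩ := h
  exact ⟨m, s, hms, hs.mono hy⟩

variable [DiscreteArith M] {S : Set (Set M)}

section Definability

variable [hS : Fact (IsModelRCA0 S)] {α : Type u} [Ctx M α]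

instance IsDelta.fits (f g k : α → M) [IsFn S f] [IsFn S g] [IsFn S k] :
    IsDelta S (fun x => Fits (f x) (g x) (k x)) := by
  refine IsDelta.comp₃ (P := fun a b c => Fits a b c) ?_ f g k
  refine (inferInstance : IsDelta S fun y : (M × M) × M => ∀ i, i < y.2 → ∀ j, j < y.2 →
    InCode y.2 (pair i j) → ∃ b, b < y.1.2 ∧ InCode y.1.2 (pair i b) ∧
      InCode y.1.1 (pair b j)).congr fun ⟨⟨g, y⟩, s⟩ => ⟨fun h i _ j _ hij => ?_,
        fun h i j hij => ?_⟩
  · obtain ⟨b, hb, hbj⟩ := h i j hij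
    exact ⟨b, hb.right_lt, hb, hbj⟩
  · obtain ⟨b, -, hb⟩ := h i hij.left_lt j hij.right_lt hij
    exact ⟨b, hb⟩

instance IsSigma.meets (E : Set M) [Fact (E ∈ S)] (f g k : α → M) [IsFn S f] [IsFn S g]
    [IsFn S k] : IsSigma S (fun x => Meets E (f x) (g x) (k x)) := by
  refine IsSigma.comp₃ (P := fun a b c => Meets E a b c) ?_ f g k
  unfold Meets
  infer_instance

end Definability

/-- Composition of strings. -/
theorem exists_comp {k b g y l : M} (hg : IsOrderedSeq k g) (hgl : IsSeq g b)
    (hy : IsOrderedSeq b y) (hyl : IsSeq y l) (hS : IsModelRCA0 S) :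
    ∃ t, IsSeq t l ∧ IsOrderedSeq k t ∧
      ∀ i j, InCode t (pair i j) ↔ ∃ c, InCode y (pair i c) ∧ InCode g (pair c j) := by
  have := Fact.mk hS
  obtain ⟨t, ht, htR⟩ := exists_seq_of_forall_exists (S := S) (l := l)
    (fun i j => ∃ c, InCode y (pair i c) ∧ InCode g (pair c j)) (fun i hi => by
      obtain ⟨c, hc⟩ := hyl.exists_value hi
      obtain ⟨j, hj⟩ := hgl.exists_value (hy.2.1 _ _ hc)
      exact ⟨j, c, hc, hj⟩)
  have key : ∀ i j, InCode t (pair i j) ↔ ∃ c, InCode y (pair i c) ∧ InCode g (pair c j) := by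
    refine fun i j => ⟨htR i j, fun ⟨c, hc, hcj⟩ => ?_⟩
    obtain ⟨j', hj'⟩ := ht.exists_value (hyl.lt_length hc)
    obtain ⟨c', hc', hcj'⟩ := htR i j' hj'
    rw [hyl.value_unique hc' hc] at hcj'
    rwa [hgl.value_unique hcj hcj']
  refine ⟨t, ht, ⟨⟨l, ht⟩, fun n i hni => ?_, fun n i hni j hj => ?_, fun i hi => ?_⟩, key⟩
  · obtain ⟨c, -, hc⟩ := htR n i hni
    exact hg.2.1 _ _ hc
  · obtain ⟨c, hc, hci⟩ := htR n i hni
    obtain ⟨c', hc', hcj⟩ := hg.2.2.1 c i hci j hj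
    obtain ⟨m, hm, hmc⟩ := hy.2.2.1 n c hc c' hc'
    exact ⟨m, hm, (key m j).2 ⟨c', hmc, hcj⟩⟩
  · obtain ⟨c, hc⟩ := hg.2.2.2 i hi
    obtain ⟨n, hn⟩ := hy.2.2.2 c (hgl.lt_length hc)
    exact ⟨n, (key n i).2 ⟨c, hn, hc⟩⟩

/-- An extension of `y` without new values whose composition with `g` meets a given dense set. -/
theorem exists_extension_meets (hS : IsModelRCA0 S) {k : ℕ} {E : Set M} (hE : IsOpenSeqCode k E)
    (n : M) (hd : IsDenseCode k (openSection E n)) {b g y : M} (hg : IsFinPartition k g)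
    (hgl : IsSeq g b) (hy : IsOrderedSeq b y) :
    ∃ z, IsOrderedSeq b z ∧ CodeSubset y z ∧ Meets E n g z := by
  have := Fact.mk hS
  obtain ⟨l, hl⟩ := hy.1
  obtain ⟨t, htl, ht, hte⟩ := exists_comp (isFinPartition_iff.1 hg) hgl hy hl hS
  obtain ⟨m, s, hms, hst⟩ := hd t ht
  rcases hst with hst | hst
  · exact ⟨y, hy, fun _ h => h, m, s, hms, fun i j hij => (hte i j).1 (hst _ hij)⟩
  obtain ⟨n', m', s', he, hs⟩ := hE _ hms
  rw [pair_inj, pair_inj] at he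
  obtain ⟨-, -, rfl⟩ := he
  obtain ⟨l', hl'⟩ := hs.1
  have hll : l ≤ l' := htl.length_le_of_subset hl' hst
  -- Here `s` extends `g ∘ y`. Beyond the length of `y`, each symbol `s(i)` is lifted to some `c`
  -- with `g(c) = s(i)`. All such `c < b` already occur in `y`, so the result remains ordered.
  obtain ⟨z, hz, hzR⟩ := exists_seq_of_forall_exists (S := S) (l := l')
    (fun i c => InCode y (pair i c) ∨
      l ≤ i ∧ ∃ j, InCode s (pair i j) ∧ InCode g (pair c j)) (fun i hi => by
      rcases lt_or_ge i l with h | h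
      · obtain ⟨c, hc⟩ := hl.exists_value h
        exact ⟨c, Or.inl hc⟩
      · obtain ⟨j, hj⟩ := hl'.exists_value hi
        obtain ⟨c, hc⟩ := hg.2.2.2 j (hs.2.1 _ _ hj)
        exact ⟨c, Or.inr ⟨h, j, hj, hc⟩⟩)
  have hyz' : ∀ i c, InCode y (pair i c) → InCode z (pair i c) := fun i c hic => by
    have hi := hl.lt_length hic
    obtain ⟨c', hc'⟩ := hz.exists_value (hi.trans_le hll)
    rcases hzR i c' hc' with h | ⟨h, -⟩
    · rwa [hl.value_unique hic h]
    · exact absurd hi h.not_gt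
  have hyz : CodeSubset y z := hl.forall_inCode (P := fun x => InCode z x) hyz'
  refine ⟨z, ⟨⟨l', hz⟩, fun i c hic => ?_, fun i c hic d hd => ?_, fun c hc => ?_⟩, hyz, m, s, hms,
    fun i j hij => ?_⟩
  · rcases hzR i c hic with h | ⟨-, j, -, h⟩
    · exact hy.2.1 _ _ h
    · exact hgl.lt_length h
  · rcases hzR i c hic with h | ⟨hi, j, -, h⟩
    · obtain ⟨i', hi', h'⟩ := hy.2.2.1 i c h d hd
      exact ⟨i', hi', hyz _ h'⟩
    · obtain ⟨i', h'⟩ := hy.2.2.2 d (hd.trans (hgl.lt_length h))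
      exact ⟨i', (hl.lt_length h').trans_le hi, hyz _ h'⟩
  · obtain ⟨i, hi⟩ := hy.2.2.2 c hc
    exact ⟨i, hyz _ hi⟩
  · obtain ⟨c, hc⟩ := hz.exists_value (hl'.lt_length hij)
    refine ⟨c, hc, ?_⟩
    rcases hzR i c hc with h | ⟨-, j', hj', h⟩
    · obtain ⟨j', hj'⟩ := hgl.exists_value (hy.2.1 _ _ h)
      have := hst _ ((hte i j').2 ⟨c, h, hj'⟩)
      rwa [hl'.value_unique hij this]
    · rwa [hl'.value_unique hij hj']

/-- An extension that meets the first `u` dense sets, for one `g`. -/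
theorem exists_extension_forall_meets (hS : IsModelRCA0 S) {k : ℕ} {E : Set M} (hES : E ∈ S)
    (hE : IsOpenSeqCode k E) (hd : ∀ n, IsDenseCode k (openSection E n)) {b g y : M}
    (hg : IsFinPartition k g) (hgl : IsSeq g b) (hy : IsOrderedSeq b y) (u : M) :
    ∃ z, IsOrderedSeq b z ∧ CodeSubset y z ∧ ∀ n, n < u → Meets E n g z := by
  have := Fact.mk hS
  have := Fact.mk hES
  refine sigma_induction (S := S) (fun u => ∃ z, IsOrderedSeq b z ∧ CodeSubset y z ∧
    ∀ n, n < u → Meets E n g z) ⟨y, hy, fun _ h => h, fun n hn => absurd hn not_lt_zero⟩ ?_ u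
  rintro u ⟨z, hz, hyz, hzm⟩
  obtain ⟨w, hw, hzw, hwm⟩ := exists_extension_meets hS hE u (hd u) hg hgl hz
  refine ⟨w, hw, fun x hx => hzw x (hyz x hx), fun n hn => ?_⟩
  rcases (lt_add_one_iff_le.1 hn).lt_or_eq with hn | rfl
  · exact (hzm n hn).mono hzw
  · exact hwm

/-- As a set of pairs, `g` is a subset of the numbers below `pair b k`, and codes are unique. Hence
"for all `g` of length `b`" is a bounded quantifier. -/
theorem IsFinPartition.lt_codeBound (hS : IsModelRCA0 S) {k : ℕ} {b g B : M}
    (hg : IsFinPartition k g) (hgl : IsSeq g b) (hB : IsCodeBound (pair b (numeral M k)) B) :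
    g < B := by
  have := Fact.mk hS
  obtain ⟨c, hcB, hc, hce⟩ := hB.exists_code (S := S) (P := fun x => InCode g x) inferInstance
  rwa [hgl.1.ext hc fun x => ?_]
  rw [hce x]
  refine ⟨fun hx => ⟨?_, hx⟩, fun hx => hx.2⟩
  refine hgl.forall_inCode (P := fun x => x < pair b (numeral M k)) (fun i j hij => ?_) x hx
  exact pair_lt_pair_of_add_lt (add_lt_add (hgl.lt_length hij) (hg.2.1 _ _ hij))

/-- An extension that meets the first `b` dense sets, for all `g < t` of length `b`. -/
theorem exists_extension_forall_meets_all (hS : IsModelRCA0 S) {k : ℕ} {E : Set M} (hES : E ∈ S)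
    (hE : IsOpenSeqCode k E) (hd : ∀ n, IsDenseCode k (openSection E n)) {b y : M}
    (hy : IsOrderedSeq b y) (t : M) :
    ∃ z, IsOrderedSeq b z ∧ CodeSubset y z ∧
      ∀ g, g < t → IsOrderedSeq (numeral M k) g → IsSeq g b → ∀ n, n < b → Meets E n g z := by
  have := Fact.mk hS
  have := Fact.mk hES
  -- The formula is `Σ⁰₁` by collection, since `Meets` stands under bounded quantifiers only.
  refine sigma_induction (S := S) (fun t => ∃ z, IsOrderedSeq b z ∧ CodeSubset y z ∧
    ∀ g, g < t → IsOrderedSeq (numeral M k) g → IsSeq g b → ∀ n, n < b → Meets E n g z)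
    ⟨y, hy, fun _ h => h, fun g hg => absurd hg not_lt_zero⟩ ?_ t
  rintro t ⟨z, hz, hyz, hzm⟩
  by_cases ht : IsOrderedSeq (numeral M k) t ∧ IsSeq t b
  · obtain ⟨w, hw, hzw, hwm⟩ := exists_extension_forall_meets hS hES hE hd
      (isFinPartition_iff.2 ht.1) ht.2 hz b
    refine ⟨w, hw, fun x hx => hzw x (hyz x hx), fun g hgt hg hgl n hn => ?_⟩
    rcases (lt_add_one_iff_le.1 hgt).lt_or_eq with hgt | rfl
    · exact (hzm g hgt hg hgl n hn).mono hzw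
    · exact hwm n hn
  · refine ⟨z, hz, hyz, fun g hgt hg hgl n hn => ?_⟩
    rcases (lt_add_one_iff_le.1 hgt).lt_or_eq with hgt | rfl
    · exact hzm g hgt hg hgl n hn
    · exact absurd ⟨hg, hgl⟩ ht

/-- Appending a new value to an ordered string. -/
theorem exists_append (hS : IsModelRCA0 S) {b y l : M} (hy : IsOrderedSeq b y) (hl : IsSeq y l) :
    ∃ z, IsOrderedSeq (b + 1) z ∧ CodeSubset y z ∧ IsSeq z (l + 1) ∧ InCode z (pair l b) := by
  have := Fact.mk hS
  obtain ⟨z, hz, hzR⟩ := exists_seq_of_forall_exists (S := S) (l := l + 1)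
    (fun i c => InCode y (pair i c) ∨ i = l ∧ c = b) (fun i hi => by
      rcases (lt_add_one_iff_le.1 hi).lt_or_eq with hi | rfl
      · obtain ⟨c, hc⟩ := hl.exists_value hi
        exact ⟨c, Or.inl hc⟩
      · exact ⟨b, Or.inr ⟨rfl, rfl⟩⟩)
  have hyz' : ∀ i c, InCode y (pair i c) → InCode z (pair i c) := fun i c hic => by
    have hi := hl.lt_length hic
    obtain ⟨c', hc'⟩ := hz.exists_value (hi.trans (lt_add_one l))
    rcases hzR i c' hc' with h | ⟨h, -⟩
    · rwa [hl.value_unique hic h]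
    · exact absurd hi h.not_lt
  have hyz : CodeSubset y z := hl.forall_inCode (P := fun x => InCode z x) hyz'
  have hlb : InCode z (pair l b) := by
    obtain ⟨c, hc⟩ := hz.exists_value (lt_add_one l)
    rcases hzR l c hc with h | ⟨-, rfl⟩
    · exact absurd (hl.lt_length h) (lt_irrefl l)
    · exact hc
  refine ⟨z, ⟨⟨l + 1, hz⟩, fun i c hic => ?_, fun i c hic d hd => ?_, fun c hc => ?_⟩, hyz, hz, hlb⟩
  · rcases hzR i c hic with h | ⟨-, rfl⟩
    · exact (hy.2.1 _ _ h).trans (lt_add_one b)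
    · exact lt_add_one c
  · rcases hzR i c hic with h | ⟨rfl, rfl⟩
    · obtain ⟨i', hi', h'⟩ := hy.2.2.1 i c h d hd
      exact ⟨i', hi', hyz _ h'⟩
    · obtain ⟨i', h'⟩ := hy.2.2.2 d hd
      exact ⟨i', hl.lt_length h', hyz _ h'⟩
  · rcases (lt_add_one_iff_le.1 hc).lt_or_eq with hc | rfl
    · obtain ⟨i, hi⟩ := hy.2.2.2 c hc
      exact ⟨i, hyz _ hi⟩
    · exact ⟨l, hlb⟩

/-- The generic sequence of nested ordered strings. -/
theorem exists_generic_strings (hS : IsModelRCA0 S) {k : ℕ} {E : Set M} (hES : E ∈ S)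
    (hE : IsOpenSeqCode k E) (hd : ∀ n, IsDenseCode k (openSection E n)) :
    ∃ F : M → M, IsFn S (fun y : PUnit.{u + 1} × M => F y.2) ∧ (∀ n, IsOrderedSeq (n + 1) (F n)) ∧
      (∀ n, CodeSubset (F n) (F (n + 1))) ∧
      ∀ t, 0 < t → ∀ g, IsFinPartition k g → IsSeq g (t + 1) → ∀ n, n ≤ t → Meets E n g (F t) := by
  have := Fact.mk hS
  have := Fact.mk hES
  obtain ⟨a, ha⟩ : ∃ a : M, IsOrderedSeq (0 + 1) a := by
    obtain ⟨a, ha, hae⟩ := exists_seq (S := S) (fun _ => 0) (0 + 1)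
    refine ⟨a, ⟨_, ha⟩, fun n i hni => ?_, fun n i hni j hj => ?_, fun i hi => ⟨0, ?_⟩⟩
    · rw [((hae n i).1 hni).2]
      exact lt_add_one 0
    · rw [((hae n i).1 hni).2] at hj
      exact absurd hj not_lt_zero
    · exact (hae 0 i).2 ⟨lt_add_one 0, le_antisymm (lt_add_one_iff_le.1 hi) zero_le⟩
  obtain ⟨F, hF, hFV, hFR⟩ := exists_dependent_choice (S := S)
    (fun n y => IsOrderedSeq (n + 1) y)
    -- Stage `n + 1` appends the new value `n + 1`, then extends without new values to serve all `g`
    -- of length `n + 2`. The starting string meets no requirement, whence `0 < t` in the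
    -- conclusion.
    (fun n y z => CodeSubset y z ∧ ∃ B, IsCodeBound (pair (n + 1 + 1) (numeral M k)) B ∧
      ∀ g, g < B → IsOrderedSeq (numeral M k) g → IsSeq g (n + 1 + 1) →
        ∀ n', n' < n + 1 + 1 → Meets E n' g z) ha (fun n y hy => by
      obtain ⟨l, hl⟩ := hy.1
      obtain ⟨w, hw, hyw, -⟩ := exists_append hS hy hl
      obtain ⟨B, hB⟩ := exists_isCodeBound S (pair (n + 1 + 1) (numeral M k))
      obtain ⟨z, hz, hwz, hzm⟩ := exists_extension_forall_meets_all hS hES hE hd hw B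
      exact ⟨z, hz, fun x hx => hwz x (hyw x hx), B, hB, hzm⟩)
    (by infer_instance) (by infer_instance)
  refine ⟨F, hF, hFV, fun n => (hFR n).1, fun t ht g hg hgl n hn => ?_⟩
  obtain ⟨s, hs⟩ := (lt_iff_exists_eq_add _ _).1 ht
  rw [zero_add] at hs
  subst hs
  obtain ⟨-, B, hB, hm⟩ := hFR s
  exact hm g (hg.lt_codeBound hS hgl hB) hg hgl n (lt_add_one_iff_le.2 hn)

/-- The partition given by a nested sequence of ordered strings. -/
theorem exists_limit_partition (hS : IsModelRCA0 S) {F : M → M}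
    (hF : IsFn S (fun y : PUnit.{u + 1} × M => F y.2)) (hFo : ∀ n, IsOrderedSeq (n + 1) (F n))
    (hFs : ∀ n, CodeSubset (F n) (F (n + 1))) :
    ∃ y ∈ S, IsInfPartition y ∧ ∀ n, IsPrefix (F n) y := by
  have := Fact.mk hS
  have {β : Type u} [Ctx M β] (f : β → M) [IsFn S f] : IsFn S (fun y => F (f y)) := hF.comp₁ f
  have hmono : ∀ n m, CodeSubset (F n) (F (n + m)) := fun n m =>
    delta_induction (S := S) (fun m => CodeSubset (F n) (F (n + m)))
      (by rw [add_zero]; exact fun _ h => h)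
      (fun m hm x hx => by rw [← add_assoc]; exact hFs _ x (hm x hx)) m
  have hmono' : ∀ n m, n ≤ m → CodeSubset (F n) (F m) := fun n m hnm => by
    obtain ⟨d, rfl⟩ := exists_add_of_le hnm
    exact hmono n d
  -- The value `n + 1` occurs in `F (n + 1)` but not in `F n`, so lengths strictly increase and
  -- position `n` is decided by `F n`.
  have hlen : ∀ n, ∃ j, j < F n ∧ InCode (F n) (pair n j) := fun n => by
    refine delta_induction (S := S) (fun n => ∃ j, j < F n ∧ InCode (F n) (pair n j)) ?_ ?_ n
    · obtain ⟨l, hl⟩ := (hFo 0).1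
      obtain ⟨i, hi⟩ := (hFo 0).2.2.2 0 (lt_add_one_iff_le.2 le_rfl)
      obtain ⟨j, hj⟩ := hl.exists_value (zero_le.trans_lt (hl.lt_length hi))
      exact ⟨j, hj.right_lt, hj⟩
    · rintro n ⟨j, -, hj⟩
      obtain ⟨l, hl⟩ := (hFo n).1
      obtain ⟨l', hl'⟩ := (hFo (n + 1)).1
      obtain ⟨i, hi⟩ := (hFo (n + 1)).2.2.2 (n + 1) (lt_add_one _)
      have hli : l ≤ i := by
        rw [← not_lt]
        intro hil
        obtain ⟨b, hb⟩ := hl.exists_value hil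
        have := (hFo n).2.1 _ _ hb
        rw [hl'.value_unique (hFs n _ hb) hi] at this
        exact lt_irrefl _ this
      obtain ⟨j', hj'⟩ := hl'.exists_value
        ((add_one_le_iff_lt.2 (hl.lt_length hj)).trans_lt (hli.trans_lt (hl'.lt_length hi)))
      exact ⟨j', hj'.right_lt, hj'⟩
  obtain ⟨y, hyS, hyf, hy⟩ := exists_graph (S := S) (fun i j => ∃ n, InCode (F n) (pair i j))
    (fun i => by
      obtain ⟨j, -, hj⟩ := hlen i
      refine ⟨j, ⟨i, hj⟩, ?_⟩
      rintro j' ⟨n, hn⟩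
      obtain ⟨l, hl⟩ := (hFo (max n i)).1
      exact hl.value_unique (hmono' n _ (le_max_left _ _) _ hn)
        (hmono' i _ (le_max_right _ _) _ hj))
  refine ⟨y, hyS, ⟨hyf, fun n i hni j hj => ?_, fun i => ?_⟩, fun n => ?_⟩
  · obtain ⟨s, hs⟩ := (hy n i).1 hni
    obtain ⟨m, hm, hmj⟩ := (hFo s).2.2.1 n i hs j hj
    exact ⟨m, hm, (hy m j).2 ⟨s, hmj⟩⟩
  · obtain ⟨n, hn⟩ := (hFo i).2.2.2 i (lt_add_one i)
    exact ⟨n, (hy n i).2 ⟨i, hn⟩⟩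
  · obtain ⟨l, hl⟩ := (hFo n).1
    exact hl.forall_inCode (P := (· ∈ y)) fun i j hij => (hy i j).2 ⟨n, hij⟩

/-- The composition of two infinite partitions. -/
theorem IsInfPartition.exists_comp (hS : IsModelRCA0 S) {y q : Set M} (hyS : y ∈ S) (hqS : q ∈ S)
    (hy : IsInfPartition y) (hq : IsInfPartition q) :
    ∃ p ∈ S, IsInfPartition p ∧ ∀ n a, pair n a ∈ p ↔ ∃ b, pair n b ∈ y ∧ pair b a ∈ q := by
  have := Fact.mk hS
  have := Fact.mk hyS
  have := Fact.mk hqS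
  obtain ⟨p, hpS, hpf, hp⟩ := exists_graph (S := S) (fun n a => ∃ b, pair n b ∈ y ∧ pair b a ∈ q)
    (fun n => by
      obtain ⟨b, hb⟩ := hy.1.exists_value n
      obtain ⟨a, ha⟩ := hq.1.exists_value b
      refine ⟨a, ⟨b, hb, ha⟩, ?_⟩
      rintro a' ⟨b', hb', ha'⟩
      rw [hy.1.value_unique hb' hb] at ha'
      exact hq.1.value_unique ha' ha)
  refine ⟨p, hpS, ⟨hpf, fun n a hna c hc => ?_, fun a => ?_⟩, hp⟩
  · obtain ⟨b, hb, ha⟩ := (hp n a).1 hna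
    obtain ⟨b', hb', hc'⟩ := hq.2.1 b a ha c hc
    obtain ⟨m, hm, hmb⟩ := hy.2.1 n b hb b' hb'
    exact ⟨m, hm, (hp m c).2 ⟨b', hmb, hc'⟩⟩
  · obtain ⟨b, hb⟩ := hq.2.2 a
    obtain ⟨n, hn⟩ := hy.2.2 b
    exact ⟨n, (hp n a).2 ⟨b, hn, hb⟩⟩

/-- A coarsening of a composition factors through the inner partition. -/
theorem IsCoarsening.exists_factor (hS : IsModelRCA0 S) {k : ℕ} {y q p x : Set M} (hyS : y ∈ S)
    (hxS : x ∈ S) (hy : IsInfPartition y) (hq : IsInfPartition q)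
    (hp : ∀ n a, pair n a ∈ p ↔ ∃ b, pair n b ∈ y ∧ pair b a ∈ q) (hx : IsCoarsening k p x) :
    ∃ h ∈ S, IsCoarsening k q h ∧ ∀ n b j, pair n b ∈ y → pair b j ∈ h → pair n j ∈ x := by
  have := Fact.mk hS
  have := Fact.mk hyS
  have := Fact.mk hxS
  have hxy : ∀ n m b b' a j, pair n b ∈ y → pair m b' ∈ y → pair b a ∈ q → pair b' a ∈ q →
      pair n j ∈ x → pair m j ∈ x := fun n m b b' a j hn hm hb hb' hj =>
    hx.2 n m a ((hp _ _).2 ⟨b, hn, hb⟩) ((hp _ _).2 ⟨b', hm, hb'⟩) j hj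
  have hxy' : ∀ n m b j, pair n b ∈ y → pair m b ∈ y → pair n j ∈ x → pair m j ∈ x :=
    fun n m b j hn hm hj => by
      obtain ⟨a, ha⟩ := hq.1.exists_value b
      exact hxy n m b b a j hn hm ha ha hj
  -- `h(b)` is the constant value of `x` on the `b`-th block of `y`.
  obtain ⟨h, hhS, hhf, hh⟩ := exists_graph (S := S) (fun b j => ∃ n, pair n b ∈ y ∧ pair n j ∈ x)
    (fun b => by
      obtain ⟨n, hn⟩ := hy.2.2 b
      obtain ⟨j, hj⟩ := hx.1.1.exists_value n
      refine ⟨j, ⟨n, hn, hj⟩, ?_⟩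
      rintro j' ⟨m, hm, hj'⟩
      exact hx.1.1.value_unique (hxy' m n b j' hm hn hj') hj)
  have hhx : ∀ n b j, pair n b ∈ y → pair b j ∈ h → pair n j ∈ x := fun n b j hn hj => by
    obtain ⟨m, hm, hmj⟩ := (hh b j).1 hj
    exact hxy' m n b j hm hn hmj
  refine ⟨h, hhS, ⟨⟨hhf, fun b j hj => ?_, fun b i hi j hj => ?_, fun j hj => ?_⟩,
    fun b b' a hb hb' j hj => ?_⟩, hhx⟩
  · obtain ⟨n, -, hn⟩ := (hh b j).1 hj
    exact hx.1.2.1 n j hn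
  · obtain ⟨n₀, hn₀⟩ := hy.2.2 b
    -- Orderedness of `h` is tested at the first element `n` of block `b`: a smaller color occurs in
    -- `x` at some `m < n`, and the block of `m` precedes `b` because `y` is ordered.
    obtain ⟨n, hn, hmin⟩ := exists_least (S := S) (fun n => pair n b ∈ y) hn₀
    obtain ⟨m, hm, hmj⟩ := hx.1.2.2.1 n i (hhx n b i hn hi) j hj
    obtain ⟨c, hc⟩ := hy.1.exists_value m
    refine ⟨c, ?_, (hh c j).2 ⟨m, hc, hmj⟩⟩
    rcases lt_trichotomy c b with hcb | rfl | hcb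
    · exact hcb
    · exact absurd hc (hmin m hm)
    · obtain ⟨m', hm', hb⟩ := hy.2.1 m c hc b hcb
      exact absurd hb (hmin m' (hm'.trans hm))
  · obtain ⟨n, hn⟩ := hx.1.2.2.2 j hj
    obtain ⟨b, hb⟩ := hy.1.exists_value n
    exact ⟨b, (hh b j).2 ⟨n, hb, hn⟩⟩
  · obtain ⟨n, hn, hnj⟩ := (hh b j).1 hj
    obtain ⟨m, hm⟩ := hy.2.2 b'
    exact (hh b' j).2 ⟨m, hm, hxy n m b b' a j hn hm hb hb' hnj⟩

/-- Along a generic `y`, the color of `h ∘ y` can be chosen to depend only on `h ↾ μ^h(k-1)`, and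
the dense sets are met automatically. -/
theorem CDRT.baireDRT (hS : IsModelRCA0 S) {k ℓ : ℕ} (hk : 2 ≤ k) (h : CDRT S k ℓ) :
    BaireDRT S k ℓ := by
  intro O D hOS hDS hcol
  have := Fact.mk hS
  have (i : Fin ℓ) := Fact.mk (hOS i)
  have := Fact.mk hDS
  let E : Set M := {z | (∃ w, w ≤ z ∧ z = pair 0 w ∧ ∃ j, w ∈ O j) ∨
    ∃ i, i ≤ z ∧ ∃ w, w ≤ z ∧ z = pair (i + 1) w ∧ pair i w ∈ D}
  have hES : E ∈ S := delta_comprehension (S := S) _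
  have hE0 : ∀ w, pair 0 w ∈ E ↔ ∃ j, w ∈ O j := by
    refine fun w => ⟨?_, fun h => Or.inl ⟨w, right_le_pair _ _, rfl, h⟩⟩
    rintro (⟨w', -, he, h⟩ | ⟨i, -, w', -, he, -⟩) <;> rw [pair_inj] at he
    · rwa [he.2]
    · exact absurd he.1.symm (hS.succ_ne_zero i)
  have hEs : ∀ i w, pair (i + 1) w ∈ E ↔ pair i w ∈ D := by
    refine fun i w => ⟨?_, fun h => Or.inr ⟨i, (lt_add_one i).le.trans (left_le_pair _ _), w,
      right_le_pair _ _, rfl, h⟩⟩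
    rintro (⟨w', -, he, h⟩ | ⟨i', -, w', -, he, h⟩) <;> rw [pair_inj] at he
    · exact absurd he.1 (hS.succ_ne_zero i)
    · rwa [hS.succ_inj _ _ he.1, he.2]
  have hEo : IsOpenSeqCode k E := by
    rintro z (⟨w, -, rfl, j, hj⟩ | ⟨i, -, w, -, rfl, hw⟩)
    · obtain ⟨n, s, rfl, hs⟩ := hcol.2.2.1 j w hj
      exact ⟨0, n, s, rfl, hs⟩
    · obtain ⟨i', n, s, he, hs⟩ := hcol.1 _ hw
      rw [pair_inj] at he
      exact ⟨i + 1, n, s, by rw [he.2], hs⟩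
  have hEd : ∀ n, IsDenseCode k (openSection E n) := by
    intro n t ht
    rcases DiscreteArith.eq_zero_or_add_one n with rfl | ⟨i, rfl⟩
    · obtain ⟨m, s, hms, hst⟩ := hcol.2.2.2 t ht
      exact ⟨m, s, (hE0 _).2 (Set.mem_iUnion.1 hms), hst⟩
    · obtain ⟨m, s, hms, hst⟩ := hcol.2.1 i t ht
      exact ⟨m, s, (hEs _ _).2 hms, hst⟩
  obtain ⟨F, hF, hFo, hFs, hFm⟩ := exists_generic_strings hS hES hEo hEd
  obtain ⟨y, hyS, hy, hFy⟩ := exists_limit_partition hS hF hFo hFs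
  have {β : Type u} [Ctx M β] (f : β → M) [IsFn S f] : IsFn S (fun y => F (f y)) := hF.comp₁ f
  -- Meeting `O c` is only `Σ⁰₁`. Selecting one witness `W t` makes the color classes `Δ⁰₁`, hence
  -- sets of the model.
  obtain ⟨W, hW, hWR⟩ := exists_selector (S := S) (α := PUnit.{u + 1} × M)
    (fun t w => IsOrderedSeq (numeral M (k - 1)) t.2 → ∃ g l, IsSeq t.2 l ∧ IsSeq g (l + 1) ∧
      CodeSubset t.2 g ∧ InCode g (pair l (numeral M (k - 1))) ∧ (∃ c, w ∈ O c) ∧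
      ∃ n s, w = pair n s ∧ Fits g (F l) s) (fun ⟨_, t⟩ => by
      by_cases ht : IsOrderedSeq (numeral M (k - 1)) t
      · obtain ⟨l, hl⟩ := ht.1
        obtain ⟨g, hg, htg, hgl, hgk⟩ := exists_append hS ht hl
        rw [← numeral_pred_add_one hk] at hg
        -- As `k ≥ 2`, the string `t` contains the value `0` and is nonempty; `F 0` carries no
        -- guarantee.
        have hl0 : 0 < l := by
          obtain ⟨n, hn⟩ := ht.2.2.2 0 (numeral_pred_pos hk)
          exact zero_le.trans_lt (hl.lt_length hn)
        obtain ⟨n, s, hns, hs⟩ := hFm l hl0 g hg hgl 0 zero_le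
        exact ⟨pair n s, fun _ => ⟨g, l, hl, hgl, htg, hgk, (hE0 _).1 hns, n, s, rfl, hs⟩⟩
      · exact ⟨0, fun h => absurd h ht⟩)
  have {β : Type u} [Ctx M β] (f : β → M) [IsFn S f] : IsFn S (fun y => W (PUnit.unit, f y)) :=
    IsFn.comp₁ (F := fun t => W (PUnit.unit, t)) hW f
  let C (c : Fin ℓ) : Set M := {t | IsOrderedSeq (numeral M (k - 1)) t ∧ W (PUnit.unit, t) ∈ O c}
  have hCS : ∀ c, C c ∈ S := fun c => delta_comprehension (S := S) _
  have hC : IsStringColoring (k - 1) C := by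
    refine ⟨fun c t ht => ht.1, fun t ht => ?_⟩
    obtain ⟨g, l, -, -, -, -, ⟨c, hc⟩, -⟩ := hWR (PUnit.unit, t) ht
    exact ⟨c, ht, hc⟩
  obtain ⟨q, hqS, hq, c, hqc⟩ := h C hCS hC
  obtain ⟨p, hpS, hp, hpe⟩ := hy.exists_comp hS hyS hqS hq
  refine ⟨p, hpS, hp, c, fun x hxS hx => ?_⟩
  obtain ⟨f, hfS, hf, hfx⟩ := hx.exists_factor hS hyS hxS hy hq hpe
  -- Since `x = f ∘ y`, the composition of an initial segment of `f` with one of `y` is contained in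
  -- `x`.
  have hprefix : ∀ g t s, IsPrefix g f → Fits g (F t) s → IsFinPartition k s → IsPrefix s x := by
    rintro g t s hg hs ⟨⟨l, hl⟩, -⟩
    refine hl.forall_inCode (P := (· ∈ x)) fun i j hij => ?_
    obtain ⟨b, hb, hbj⟩ := hs i j hij
    exact hfx i b j (hFy t _ hb) (hg _ hbj)
  obtain ⟨m, t, hm, htm, htC⟩ := hqc f hfS hf
  constructor
  · obtain ⟨g, l, hl, hgl, htg, hgk, -, n, s, hw, hs⟩ := hWR (PUnit.unit, t) htC.1
    have hWO : pair n s ∈ O c := hw ▸ htC.2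
    obtain ⟨n', s', he, hs'⟩ := hcol.2.2.1 c _ hWO
    rw [pair_inj] at he
    rw [← he.2] at hs'
    -- `g = t⌢(k-1)` is an initial segment of `f`, because the length `l` of `t` is `μ^f(k-1)`.
    refine ⟨n, s, hWO, hprefix g l s (hgl.forall_inCode (P := (· ∈ f)) fun i j hij => ?_) hs hs'⟩
    rcases (lt_add_one_iff_le.1 (hgl.lt_length hij)).lt_or_eq with hi | rfl
    · obtain ⟨j', hj'⟩ := hl.exists_value hi
      rw [hgl.value_unique hij (htg _ hj')]
      exact htm.2 _ hj'
    · rw [hgl.value_unique hij hgk, hl.length_unique htm.1]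
      exact hm.1
  · intro n
    -- Long enough to include position `m`, where `k - 1` occurs, and for the requirement of index
    -- `n + 1`, since `D_n` is `E_{n+1}`.
    obtain ⟨g, hg⟩ := exists_restriction hfS hf.1.1 (max m (n + 1) + 1)
    have hgk := hf.1.isFinPartition_restriction hk hm.1 (lt_add_one_iff_le.2 (le_max_left _ _)) hg
    obtain ⟨n', s, hns, hs⟩ := hFm (max m (n + 1))
      ((add_pos_of_nonneg_of_pos zero_le one_pos).trans_le (le_max_right _ _)) g hgk hg.1 (n + 1)
      (le_max_right _ _)
    obtain ⟨i', n'', s', he, hs'⟩ := hEo _ hns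
    rw [pair_inj, pair_inj] at he
    rw [← he.2.2] at hs'
    exact ⟨n', s, (hEs _ _).1 hns, hprefix g _ s hg.2 hs hs'⟩

end Baire

end SecondOrderArith

open SecondOrderArith in
theorem mainTheorem1 (k ℓ : ℕ) (hk : 2 ≤ k) (hℓ : 2 ≤ ℓ)
    {M : Type*} [NumStructure M] (S : Set (Set M)) (hS : IsModelRCA0 S) :
    List.TFAE [BaireDRT S k ℓ, ODRT S k ℓ, CDRT S k ℓ] := by
  have := hS.discreteArith
  have := Fact.mk hS
  tfae_have 1 → 2 := fun h => h.odrt hk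
  tfae_have 2 → 3 := fun h => h.cdrt hk
  tfae_have 3 → 1 := fun h => h.baireDRT hS hk
  tfae_finish
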